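/- Let $s\in(0,1)$, $\beta\in(s,1)$, $\kappa\in\mathbb R$ and $0<P<\infty$. Let $\mathrm J^{-s}$ be the Fourier multiplier (on tempered distributions on $\mathbb R$) with symbol $\langle\xi\rangle^{-s}=(1+\xi^2)^{-s/2}$, and consider bounded continuous real solutions $\varphi$ with wave speed $\mu$ of the steady fDP equation $$-\mu\varphi+\tfrac12\varphi^2+\tfrac32\,\mathrm J^{-s}(\varphi^2)=\kappa\quad\text{on }\mathbb R .$$ Let $X$ be the space of even, $P$-periodic, $\beta$-Hölder continuous functions on $\mathbb R$ with the norm $\|f\|_\infty+\sup_{x\ne y}|f(x)-f(y)|/|x-y|^\beta$; below, "solution" means a solution $(\varphi,\mu)\in X\times\mathbb R$. For $\mu>0$ with $-\mu^2/8<\kappa$ the constant solutions are $\gamma_\pm(\mu)=\tfrac14\bigl(\mu\pm\sqrt{\mu^2+8\kappa}\bigr)$. The constant curves are the two curves $(\gamma_\pm(\mu),\mu)$ for these $\mu$, without the point of $\gamma_+$ at which $\gamma_+(\mu)=\mu$ (it exists only if $\kappa>0$, and is at $\mu=\sqrt\kappa$). A point of these curves is a bifurcation point if each of its neighbourhoods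 in $X\times\mathbb R$ contains a solution $(\varphi,\mu)$ with $\varphi$ nonconstant. Call an integer $k\ge1$ admissible if * (i) $\kappa<0$ and $\frac{2\pi k}{P}<\sqrt{3^{2/s}-1}$, or * (ii) $\kappa>0$ and $\frac{2\pi k}{P}>\sqrt{3^{2/s}-1}$. If $\kappa=0$, assume that $\frac{2\pi k}{P}\neq\sqrt{3^{2/s}-1}$ for all integers $k\ge 1$ (then there is no admissible $k$). Then: 1. For every admissible $k$ there is exactly one $\mu=\mu^*_{P,k}>0$ with $-\mu^2/8<\kappa$ that satisfies $$\Bigl\langle\frac{2\pi k}{P}\Bigr\rangle^{-s}=\frac13\,\frac{\mu-\gamma_+(\mu)}{\gamma_+(\mu)} .$$ It lies in $(\sqrt{-8\kappa},\infty)$ in case (i) and in $(\sqrt\kappa,\infty)$ in case (ii), and $(\gamma_+(\mu^*_{P,k}),\mu^*_{P,k})$ is a bifurcation point. There are $\varepsilon_k>0$ and a real analytic curve $t\mapsto(\varphi_{P,k}(t),\mu_{P,k}(t))\in X\times\mathbb R$ on $(-\varepsilon_k,\varepsilon_k)$, consisting of solutions, with $(\varphi_{P,k}(0),\mu_{P,k}(0))=(\gamma_+(\mu^*_{P,k}),\mu^*_{P,k})$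 and with $\varphi_{P,k}(t)$ nonconstant for $t\neq0$. 2. There are no other bifurcation points on the constant curves. 3. The curves in 1 can be chosen such that some open set of $X\times\mathbb R$ contains the constant curves, and every solution $(\varphi,\mu)$ in it with $\varphi$ nonconstant lies on one of the curves $(\varphi_{P,k}(t),\mu_{P,k}(t))$, $|t|<\varepsilon_k$, $k$ admissible. -/

import Mathlib

open Set Topology
open scoped NNReal BoundedContinuousFunction SchwartzMap

noncomputable section

namespace FDP

/-! ### The Bessel operator on bounded continuous functions -/

/-- The tempered distribution `ψ ↦ ∫ ψ f` defined by a bounded continuous function `f`. -/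
def toDistribution (f : ℝ →ᵇ ℝ) : 𝓢'(ℝ, ℂ) :=
  MeasureTheory.Lp.toTemperedDistribution (p := ⊤) (μ := MeasureTheory.volume)
    ((MeasureTheory.memLp_top_of_bound (f := fun x => (f x : ℂ))
      (Complex.continuous_ofReal.comp f.continuous).aestronglyMeasurable ‖f‖
      (Filter.Eventually.of_forall fun x => by
        rw [Complex.norm_real]; exact f.norm_coe_le_norm x)).toLp)

/-- The symbol `⟨ξ⟩^{-s} = (1 + ξ²)^{-s/2}`, where `ξ` is the angular frequency. -/
def besselSymbol (s ξ : ℝ) : ℝ := (1 + ξ ^ 2) ^ (-s / 2)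

/-- The Bessel operator `J^{-s}` on tempered distributions: the Fourier multiplier with symbol
`⟨ξ⟩^{-s}` for the Fourier transform `∫ f(x) e^{-ixξ} dx`. Mathlib's transform is
`∫ f(x) e^{-2πixη} dx`, so that `ξ = 2πη`. -/
def besselOp (s : ℝ) : 𝓢'(ℝ, ℂ) →L[ℂ] 𝓢'(ℝ, ℂ) :=
  TemperedDistribution.fourierMultiplierCLM ℂ
    (fun η : ℝ => ((besselSymbol s (2 * Real.pi * η) : ℝ) : ℂ))

/-- The symbol has temperate growth, so multiplication by it is the genuine one. -/
theorem besselSymbol_hasTemperateGrowth (s : ℝ) :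
    (fun η : ℝ => ((besselSymbol s (2 * Real.pi * η) : ℝ) : ℂ)).HasTemperateGrowth := by
  have h := (Function.hasTemperateGrowth_one_add_norm_sq_rpow ℝ (-s / 2)).comp
    (show (fun η : ℝ => (2 * Real.pi) * η).HasTemperateGrowth by fun_prop)
  have h2 : (fun η : ℝ => besselSymbol s (2 * Real.pi * η)).HasTemperateGrowth := by
    have e : (fun η : ℝ => besselSymbol s (2 * Real.pi * η)) =
        (fun x : ℝ => (1 + ‖x‖ ^ 2) ^ (-s / 2)) ∘ (fun η : ℝ => (2 * Real.pi) * η) := by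
      funext η
      simp only [besselSymbol, Function.comp_apply, Real.norm_eq_abs, sq_abs]
    rw [e]; exact h
  fun_prop

/-- The bounded continuous function `φ` is a steady fDP wave with speed `μ` and constant `κ`:
`-μ φ + φ²/2 + (3/2) J^{-s}(φ²) = κ` pointwise on `ℝ`, where `g` is the bounded continuous
function that represents `J^{-s}(φ²)`. -/
def IsSteadyWave (s κ μ : ℝ) (φ : ℝ →ᵇ ℝ) : Prop :=
  ∃ g : ℝ →ᵇ ℝ, besselOp s (toDistribution (φ ^ 2)) = toDistribution g ∧
    ∀ x, -μ * φ x + 1 / 2 * φ x ^ 2 + 3 / 2 * g x = κ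

/-! ### The space of even, `P`-periodic, `β`-Hölder functions -/

/-- The even `P`-periodic functions in `C^{0,β}(ℝ)`, as a linear subspace of the bounded
continuous functions. -/
def evenHolderSubmodule (P : ℝ) (β : ℝ≥0) : Submodule ℝ (ℝ →ᵇ ℝ) where
  carrier := {f | MemHolder β f ∧ Function.Even f ∧ Function.Periodic f P}
  zero_mem' := ⟨memHolder_zero, fun _ => rfl, fun _ => rfl⟩
  add_mem' := by
    rintro f g ⟨hf, hf', hf''⟩ ⟨hg, hg', hg''⟩
    exact ⟨hf.add hg, fun x => by simp [hf' x, hg' x], fun x => by simp [hf'' x, hg'' x]⟩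
  smul_mem' := by
    rintro c f ⟨hf, hf', hf''⟩
    exact ⟨hf.smul, fun x => by simp [hf' x], fun x => by simp [hf'' x]⟩

/-- The space `C^{0,β}_{even}` of even `P`-periodic functions. It is a type of its own, because it
does not carry the supremum norm but the Hölder norm below. -/
def EvenHolder (P : ℝ) (β : ℝ≥0) : Type := evenHolderSubmodule P β

namespace EvenHolder

variable {P : ℝ} {β : ℝ≥0}

instance : AddCommGroup (EvenHolder P β) := inferInstanceAs (AddCommGroup (evenHolderSubmodule P β))

instance : Module ℝ (EvenHolder P β) := inferInstanceAs (Module ℝ (evenHolderSubmodule P β))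

/-- The underlying bounded continuous function. -/
def toBCF : EvenHolder P β →ₗ[ℝ] (ℝ →ᵇ ℝ) := (evenHolderSubmodule P β).subtype

theorem toBCF_injective : Function.Injective (toBCF : EvenHolder P β → (ℝ →ᵇ ℝ)) :=
  Subtype.val_injective

theorem memHolder (f : EvenHolder P β) : MemHolder β (toBCF f) := f.2.1

/-- The Hölder norm `‖f‖_∞ + sup_{x ≠ y} |f x - f y| / |x - y|^β`. -/
def holderNorm : AddGroupNorm (EvenHolder P β) where
  toFun f := ‖toBCF f‖ + (nnHolderNorm β (toBCF f) : ℝ)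
  map_zero' := by
    have h : (⇑(0 : ℝ →ᵇ ℝ) : ℝ → ℝ) = 0 := rfl
    rw [map_zero, h, nnHolderNorm_zero]; simp
  add_le' f g := by
    have h := (memHolder f).nnHolderNorm_add_le (memHolder g)
    have h' : (nnHolderNorm β (⇑(toBCF f) + ⇑(toBCF g)) : ℝ) ≤
        nnHolderNorm β (toBCF f) + nnHolderNorm β (toBCF g) := by exact_mod_cast h
    have h2 := norm_add_le (toBCF f) (toBCF g)
    rw [map_add, BoundedContinuousFunction.coe_add]
    linarith
  neg' f := by
    have h := (memHolder f).nnHolderNorm_smul (-1 : ℝ)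
    have e : (⇑(-(toBCF f)) : ℝ → ℝ) = (-1 : ℝ) • ⇑(toBCF f) := by ext x; simp
    rw [map_neg, norm_neg, e, h]; simp
  eq_zero_of_map_eq_zero' f hf := by
    have h1 : ‖toBCF f‖ = 0 :=
      le_antisymm (by have := (nnHolderNorm β (toBCF f)).coe_nonneg; linarith) (norm_nonneg _)
    exact toBCF_injective (by rw [norm_eq_zero.mp h1, map_zero])

instance : NormedAddCommGroup (EvenHolder P β) := holderNorm.toNormedAddCommGroup

theorem norm_def (f : EvenHolder P β) :
    ‖f‖ = ‖toBCF f‖ + (nnHolderNorm β (toBCF f) : ℝ) := rfl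

instance : NormedSpace ℝ (EvenHolder P β) where
  norm_smul_le c f := by
    have h := (memHolder f).nnHolderNorm_smul c
    have e : (⇑(c • toBCF f) : ℝ → ℝ) = c • ⇑(toBCF f) := rfl
    rw [norm_def, norm_def, map_smul, norm_smul, e, h]
    push_cast
    exact le_of_eq (by ring)

/-- The constant function `c`. -/
def const (c : ℝ) : EvenHolder P β :=
  ⟨BoundedContinuousFunction.const ℝ c, memHolder_const' (c := c), fun _ => rfl, fun _ => rfl⟩

/-- `φ` is not a constant function. -/
def Nonconstant (φ : EvenHolder P β) : Prop := ∀ c, φ ≠ const c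

end EvenHolder

/-! ### Constant solutions and bifurcation data -/

/-- The larger constant solution with wave speed `μ`. -/
def gammaPlus (κ μ : ℝ) : ℝ := (μ + √(μ ^ 2 + 8 * κ)) / 4

/-- The smaller constant solution with wave speed `μ`. -/
def gammaMinus (κ μ : ℝ) : ℝ := (μ - √(μ ^ 2 + 8 * κ)) / 4

/-- The threshold `√(3^{2/s} - 1)` for the wave number `2πk/P`. -/
def threshold (s : ℝ) : ℝ := √((3 : ℝ) ^ (2 / s) - 1)

/-- The wave number `2πk/P`. -/
def waveNumber (P : ℝ) (k : ℕ) : ℝ := 2 * Real.pi * k / P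

/-- The indices `k` for which a branch is claimed. -/
def Admissible (s κ P : ℝ) (k : ℕ) : Prop :=
  1 ≤ k ∧ ((κ < 0 ∧ waveNumber P k < threshold s) ∨ (0 < κ ∧ threshold s < waveNumber P k))

/-- The even `P`-periodic Hölder solutions `(φ, μ)` of the steady fDP equation. -/
def solutionSet (s κ P : ℝ) (β : ℝ≥0) : Set (EvenHolder P β × ℝ) :=
  {p | IsSteadyWave s κ p.2 (EvenHolder.toBCF p.1)}

/-- The nonconstant ones among them. -/
def nonconstantSolutions (s κ P : ℝ) (β : ℝ≥0) : Set (EvenHolder P β × ℝ) :=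
  {p | p ∈ solutionSet s κ P β ∧ p.1.Nonconstant}

/-- The constant solution `(c, μ)` is a bifurcation point: nonconstant solutions exist in each of
its neighbourhoods. -/
def IsBifurcationPoint (s κ P : ℝ) (β : ℝ≥0) (c μ : ℝ) : Prop :=
  (EvenHolder.const c, μ) ∈ solutionSet s κ P β ∧
    (EvenHolder.const c, μ) ∈ closure (nonconstantSolutions s κ P β)

/-- The points `(c, μ)` of the two curves of constant solutions `c = γ_±(μ)`, `μ > 0`,
`-μ²/8 < κ`, other than the point with `c = μ` (it lies on `γ_+` and has `μ = √κ`). -/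
def constantCurves (κ : ℝ) : Set (ℝ × ℝ) :=
  {p | 0 < p.2 ∧ -p.2 ^ 2 / 8 < κ ∧ (p.1 = gammaPlus κ p.2 ∨ p.1 = gammaMinus κ p.2) ∧
    p.1 ≠ p.2}

end FDP

end

/-! The symbol `⟨ξ⟩^{-s}` is the characteristic function of a symmetric probability measure, a Gamma
mixture of Gaussians. Hence `J^{-s}` is averaging over translations (`besselOp_toDistribution`). It
is bounded on the Banach space `EvenHolder P β`, fixes constants, and multiplies the `n`-th cosine
coefficient by `b n = ⟨2πn/P⟩^{-s}` (`coeff_besselL`). Cosine coefficients determine an element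
(`ext_coeff`), so operator identities can be checked mode by mode.

Let `c` be a constant solution, `2c² - μc = κ`. As the nonlinearity is quadratic, the equation for
`u = φ - c` is exactly `L_μ u + B(u,u) = 0`, where `L_μ = (c - μ) + 3c J^{-s}` has the multipliers
`c - μ + 3c b n` (`mem_solutionSet_iff`). If `c ≠ μ`, inverting the nonzero multipliers gives a
bounded operator (`exists_pseudoinverse_linearization`): a truncated Neumann series plus a remainder
whose multipliers decay fast.

If no multiplier vanishes, small solutions satisfy `u = 0`, so all nearby solutions are constant. If
the `k`-th vanishes, then `c(1 + 3 b k) = μ`; with the quadratic equation, `κ = c²(1 - 3 b k)`. The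
sign of `κ` must be that of `1 - 3 b k`, which is admissibility, and `c` and `μ` are determined. The
bound `b k ≤ 1` excludes `γ_-` (`admissible_of_critical`).

At such a point the kernel is one-dimensional, because `b` is injective, and the critical multiplier
has nonzero `μ`-derivative along `γ_+`, because `κ ≠ 0`. Substituting `u = t w`, with the `k`-th
coefficient of `w` equal to `1`, and dividing by `t` gives an equation to which the analytic inverse
function theorem applies. An a priori estimate shows that every nearby nonzero solution has this
form, so it lies on the branch (`exists_branch_of_quadratic`). -/

noncomputable section

namespace FDP

open MeasureTheory ProbabilityTheory

/-! ### The Bessel kernel as a probability measure -/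

/-- The law of `√(2T) Z`, where `T` has the `Γ(s/2, 1)` distribution and `Z` is an independent
standard Gaussian; its characteristic function is `besselSymbol s`. -/
def besselMeasure (s : ℝ) : Measure ℝ :=
  ((gammaMeasure (s / 2) 1).prod (gaussianReal 0 1)).map (fun p : ℝ × ℝ => √(2 * p.1) * p.2)

theorem measurable_sqrt_mul : Measurable (fun p : ℝ × ℝ => √(2 * p.1) * p.2) := by fun_prop

theorem isProbabilityMeasure_besselMeasure {s : ℝ} (hs : 0 < s) :
    IsProbabilityMeasure (besselMeasure s) := by
  have := isProbabilityMeasure_gammaMeasure (half_pos hs) one_pos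
  exact Measure.isProbabilityMeasure_map measurable_sqrt_mul.aemeasurable

/-- The exponent is `-x t²`, so this is the Laplace transform of the Gamma law at `t²`. -/
theorem integral_exp_gammaMeasure {a : ℝ} (ha : 0 < a) (t : ℝ) :
    ∫ x, Real.exp (-(√(2 * x) * t) ^ 2 / 2) ∂gammaMeasure a 1 = (1 + t ^ 2) ^ (-a) := by
  have ht : 0 < 1 + t ^ 2 := by positivity
  unfold gammaMeasure gammaPDF
  rw [integral_withDensity_eq_integral_toReal_smul (by
      exact (measurable_gammaPDFReal a 1).ennreal_ofReal)
    (Filter.Eventually.of_forall fun x => ENNReal.ofReal_lt_top)]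
  simp_rw [ENNReal.toReal_ofReal (gammaPDFReal_nonneg ha one_pos _), smul_eq_mul]
  rw [← setIntegral_eq_integral_of_forall_compl_eq_zero (s := Ici 0)
    (fun x hx => by simp only [gammaPDFReal, if_neg (show ¬ 0 ≤ x from hx), zero_mul]),
    integral_Ici_eq_integral_Ioi,
    setIntegral_congr_fun (g := fun x => (1 / Real.Gamma a) *
      (x ^ (a - 1) * Real.exp (-((1 + t ^ 2) * x)))) measurableSet_Ioi]
  · rw [integral_const_mul, Real.integral_rpow_mul_exp_neg_mul_Ioi ha ht, Real.rpow_neg ht.le]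
    simp only [one_div]
    rw [Real.inv_rpow ht.le]
    field_simp [(Real.Gamma_pos_of_pos ha).ne']
  · intro x hx
    have hx : 0 < x := hx
    have e : (√(2 * x) * t) ^ 2 = 2 * x * t ^ 2 := by
      rw [mul_pow, Real.sq_sqrt (by positivity)]
    simp only [gammaPDFReal, if_pos hx.le, Real.one_rpow, e]
    rw [mul_assoc, mul_assoc, ← Real.exp_add]
    ring_nf

/-- Conditionally on `T` the variable is a centred Gaussian of variance `2T`; integrating its
characteristic function over `T` leaves the Gamma Laplace transform. -/
theorem charFun_besselMeasure {s : ℝ} (hs : 0 < s) (t : ℝ) :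
    charFun (besselMeasure s) t = (besselSymbol s t : ℂ) := by
  have := isProbabilityMeasure_gammaMeasure (half_pos hs) one_pos
  have hb (x : ℝ) : ‖Complex.exp (t * x * Complex.I)‖ ≤ 1 := by
    have := Complex.norm_exp_ofReal_mul_I (t * x)
    push_cast at this; exact this.le
  have hc : Continuous fun x : ℝ => Complex.exp (t * x * Complex.I) := by fun_prop
  rw [charFun_apply_real, besselMeasure, integral_map measurable_sqrt_mul.aemeasurable
    hc.aestronglyMeasurable, integral_prod]
  · have h (x : ℝ) : ∫ y, Complex.exp (t * ((√(2 * x) * y : ℝ) : ℂ) * Complex.I) ∂gaussianReal 0 1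
        = ((Real.exp (-(√(2 * x) * t) ^ 2 / 2) : ℝ) : ℂ) := by
      have := charFun_gaussianReal (μ := 0) (v := 1) (√(2 * x) * t)
      rw [charFun_apply_real] at this
      convert! this using 1
      · congr 1; ext y; congr 1; push_cast; ring
      · push_cast; congr 1; simp; ring
    simp_rw [h]
    rw [integral_complex_ofReal, integral_exp_gammaMeasure (half_pos hs), besselSymbol, neg_div]
  · refine Integrable.of_bound (C := 1) ?_ (Filter.Eventually.of_forall fun p => hb _)
    exact (hc.measurable.comp measurable_sqrt_mul).aestronglyMeasurable

theorem besselSymbol_neg (s ξ : ℝ) : besselSymbol s (-ξ) = besselSymbol s ξ := by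
  simp [besselSymbol]

theorem map_neg_besselMeasure {s : ℝ} (hs : 0 < s) :
    (besselMeasure s).map Neg.neg = besselMeasure s := by
  have := isProbabilityMeasure_besselMeasure hs
  have : IsProbabilityMeasure ((besselMeasure s).map Neg.neg) :=
    Measure.isProbabilityMeasure_map measurable_neg.aemeasurable
  refine Measure.ext_of_charFun (funext fun t => ?_)
  rw [charFun_besselMeasure hs, ← besselSymbol_neg, ← charFun_besselMeasure hs, charFun_apply_real,
    charFun_apply_real, integral_map measurable_neg.aemeasurable]
  · simp
  · exact Continuous.aestronglyMeasurable (by fun_prop)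

theorem integral_comp_neg_besselMeasure {s : ℝ} (hs : 0 < s) {E : Type*} [NormedAddCommGroup E]
    [NormedSpace ℝ E] (f : ℝ → E) :
    ∫ y, f (-y) ∂besselMeasure s = ∫ y, f y ∂besselMeasure s := by
  conv_rhs => rw [← map_neg_besselMeasure hs]
  exact ((Homeomorph.neg ℝ).measurableEmbedding.integral_map f).symm

theorem integral_cos_besselMeasure {s : ℝ} (hs : 0 < s) (ω : ℝ) :
    ∫ y, Real.cos (ω * y) ∂besselMeasure s = besselSymbol s ω := by
  have := isProbabilityMeasure_besselMeasure hs
  have h := congrArg Complex.re (charFun_besselMeasure hs ω)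
  rw [charFun_apply_real, ← RCLike.re_eq_complex_re, ← integral_re,
    show RCLike.re ((besselSymbol s ω : ℝ) : ℂ) = besselSymbol s ω from Complex.ofReal_re _] at h
  · rw [← h]
    congr 1; ext y
    have := Complex.exp_ofReal_mul_I_re (ω * y)
    push_cast at this
    exact this.symm
  · refine Integrable.of_bound (C := 1) (Continuous.aestronglyMeasurable (by fun_prop))
      (Filter.Eventually.of_forall fun x => ?_)
    have := Complex.norm_exp_ofReal_mul_I (ω * x)
    push_cast at this; exact this.le

end FDP
end

noncomputable section

namespace FDP

open MeasureTheory ProbabilityTheory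
open scoped FourierTransform

/-! ### The Bessel operator as a convolution -/

theorem integrable_shift {s : ℝ} (hs : 0 < s) (f : ℝ →ᵇ ℝ) (x : ℝ) :
    Integrable (fun y => f (x + y)) (besselMeasure s) := by
  have := isProbabilityMeasure_besselMeasure hs
  exact Integrable.of_bound (C := ‖f‖)
    (f.continuous.comp (continuous_const.add continuous_id)).aestronglyMeasurable
    (Filter.Eventually.of_forall fun y => f.norm_coe_le_norm _)

/-- The convolution of a bounded continuous function with the Bessel kernel. -/
def besselConv {s : ℝ} (hs : 0 < s) (f : ℝ →ᵇ ℝ) : ℝ →ᵇ ℝ :=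
  haveI := isProbabilityMeasure_besselMeasure hs
  BoundedContinuousFunction.ofNormedAddCommGroup (fun x => ∫ y, f (x + y) ∂besselMeasure s)
    (continuous_of_dominated
      (fun x => (integrable_shift hs f x).aestronglyMeasurable)
      (fun x => Filter.Eventually.of_forall fun y => f.norm_coe_le_norm _)
      (integrable_const ‖f‖)
      (Filter.Eventually.of_forall fun y => f.continuous.comp (continuous_id.add continuous_const)))
    ‖f‖ (fun x => by
      refine (norm_integral_le_of_norm_le_const
        (Filter.Eventually.of_forall fun y => f.norm_coe_le_norm _)).trans ?_
      simp)

theorem besselConv_apply {s : ℝ} (hs : 0 < s) (f : ℝ →ᵇ ℝ) (x : ℝ) :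
    besselConv hs f x = ∫ y, f (x + y) ∂besselMeasure s := rfl

theorem norm_besselConv_le {s : ℝ} (hs : 0 < s) (f : ℝ →ᵇ ℝ) : ‖besselConv hs f‖ ≤ ‖f‖ :=
  BoundedContinuousFunction.norm_ofNormedAddCommGroup_le _ (norm_nonneg f) _

theorem toDistribution_apply (f : ℝ →ᵇ ℝ) (ψ : 𝓢(ℝ, ℂ)) :
    toDistribution f ψ = ∫ x, ψ x * (f x : ℂ) := by
  rw [toDistribution, Lp.toTemperedDistribution_apply]
  refine integral_congr_ae ?_
  filter_upwards [MemLp.coeFn_toLp (memLp_top_of_bound (f := fun x => (f x : ℂ))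
      (Complex.continuous_ofReal.comp f.continuous).aestronglyMeasurable ‖f‖
      (Filter.Eventually.of_forall fun x => by
        rw [Complex.norm_real]; exact f.norm_coe_le_norm x) : MemLp _ ⊤ volume)] with x hx
  rw [hx, smul_eq_mul]

/-- Makes the representative `g` in `IsSteadyWave` unique: equal distributions agree almost
everywhere, and continuous functions that do so are equal. -/
theorem toDistribution_injective : Function.Injective toDistribution := by
  intro f g h
  have h2 := (LinearMap.ker_eq_bot.mp
    (Lp.ker_toTemperedDistributionCLM_eq_bot (F := ℂ) (μ := (volume : Measure ℝ)) (p := ⊤))) h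
  rw [MemLp.toLp_eq_toLp_iff] at h2
  have h3 := (Continuous.ae_eq_iff_eq volume (Complex.continuous_ofReal.comp f.continuous)
    (Complex.continuous_ofReal.comp g.continuous)).mp h2
  ext x
  exact Complex.ofReal_injective (congrFun h3 x)

/-- The multiplier acts on distributions through test functions. Writing the symbol as a
characteristic function and applying Fubini turns its action there into an average of translates. -/
theorem fourier_symbol_mul_fourierInv {s : ℝ} (hs : 0 < s) (ψ : 𝓢(ℝ, ℂ)) (x : ℝ) :
    (𝓕 (SchwartzMap.smulLeftCLM ℂ
      (fun η : ℝ => ((besselSymbol s (2 * Real.pi * η) : ℝ) : ℂ)) (𝓕⁻ ψ)) : 𝓢(ℝ, ℂ)) x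
      = ∫ y, ψ (x + y) ∂besselMeasure s := by
  have := isProbabilityMeasure_besselMeasure hs
  set θ : 𝓢(ℝ, ℂ) := 𝓕⁻ ψ with hθ
  have hψ : ψ = 𝓕 θ := by rw [hθ]; simp
  have hF (χ : 𝓢(ℝ, ℂ)) (w : ℝ) : (𝓕 χ : 𝓢(ℝ, ℂ)) w =
      ∫ v : ℝ, Complex.exp (↑(-2 * Real.pi * v * w) * Complex.I) * χ v := by
    rw [SchwartzMap.fourier_coe, Real.fourier_real_eq_integral_exp_smul]
    rfl
  rw [hψ, hF]
  simp_rw [hF]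
  rw [integral_integral_swap]
  · congr 1; ext v
    rw [SchwartzMap.smulLeftCLM_apply_apply (besselSymbol_hasTemperateGrowth s), smul_eq_mul,
      ← besselSymbol_neg, ← charFun_besselMeasure hs, charFun_apply_real, integral_mul_const,
      ← mul_assoc, ← integral_const_mul]
    congr 2; ext y
    rw [← Complex.exp_add]
    push_cast; ring_nf
  · have h1 : Integrable (fun p : ℝ × ℝ => (1 : ℂ) * θ p.2) ((besselMeasure s).prod volume) :=
      (integrable_const (1 : ℂ)).mul_prod θ.integrable
    simp only [one_mul] at h1
    have h2 : AEStronglyMeasurable (fun p : ℝ × ℝ =>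
        Complex.exp (↑(-2 * Real.pi * p.2 * (x + p.1)) * Complex.I))
        ((besselMeasure s).prod volume) := Continuous.aestronglyMeasurable (by fun_prop)
    have h3 : ∀ᵐ p ∂((besselMeasure s).prod (volume : Measure ℝ)),
        ‖Complex.exp (↑(-2 * Real.pi * p.2 * (x + p.1)) * Complex.I)‖ ≤ 1 :=
      Filter.Eventually.of_forall fun p => (Complex.norm_exp_ofReal_mul_I _).le
    exact h1.bdd_mul h2 h3

theorem besselOp_toDistribution {s : ℝ} (hs : 0 < s) (f : ℝ →ᵇ ℝ) :
    besselOp s (toDistribution f) = toDistribution (besselConv hs f) := by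
  have := isProbabilityMeasure_besselMeasure hs
  ext ψ
  rw [besselOp, TemperedDistribution.fourierMultiplierCLM_apply_apply, toDistribution_apply,
    toDistribution_apply]
  simp_rw [fourier_symbol_mul_fourierInv hs, besselConv_apply]
  have hfb (x : ℝ) : ‖(f x : ℂ)‖ ≤ ‖f‖ := by
    rw [Complex.norm_real]; exact f.norm_coe_le_norm x
  have hfc : Continuous fun x => (f x : ℂ) := Complex.continuous_ofReal.comp f.continuous
  have h1 : Integrable (fun p : ℝ × ℝ => ψ p.1) (volume.prod (besselMeasure s)) := by
    simpa using ψ.integrable.mul_prod (integrable_const (μ := besselMeasure s) (1 : ℂ))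
  have h2 : Integrable (fun p : ℝ × ℝ => ψ p.1 * (f (p.1 + p.2) : ℂ))
      (volume.prod (besselMeasure s)) :=
    h1.mul_bdd (c := ‖f‖) (Continuous.aestronglyMeasurable (by fun_prop))
      (Filter.Eventually.of_forall fun p => hfb _)
  have h3 : Integrable (fun p : ℝ × ℝ => ψ (p.1 + p.2) * (f p.1 : ℂ))
      (volume.prod (besselMeasure s)) := by
    refine Integrable.mul_bdd (c := ‖f‖) ?_ (Continuous.aestronglyMeasurable (by fun_prop))
      (Filter.Eventually.of_forall fun p => hfb _)
    -- Each slice in `x` is a translate of `ψ`, so its `L¹` norm does not depend on `y`.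
    rw [integrable_prod_iff' (Continuous.aestronglyMeasurable (by fun_prop))]
    refine ⟨Filter.Eventually.of_forall fun y => ψ.integrable.comp_add_right y, ?_⟩
    exact (integrable_const (∫ x, ‖ψ x‖)).congr (Filter.Eventually.of_forall fun y =>
      (integral_add_right_eq_self (fun x => ‖ψ x‖) y).symm)
  calc ∫ x, (∫ y, ψ (x + y) ∂besselMeasure s) * (f x : ℂ)
      = ∫ x, ∫ y, ψ (x + y) * (f x : ℂ) ∂besselMeasure s := by
        congr 1; ext x; exact (integral_mul_const _ _).symm
    _ = ∫ y, (∫ x, ψ (x + y) * (f x : ℂ)) ∂besselMeasure s := integral_integral_swap h3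
    _ = ∫ y, (∫ x, ψ x * (f (x + -y) : ℂ)) ∂besselMeasure s := by
        congr 1; ext y
        rw [← integral_add_right_eq_self (fun x => ψ x * (f (x + -y) : ℂ)) y]
        simp
    -- The symmetry of the kernel removes the reflection that moving the translation from `ψ` to `f`
    -- produced.
    _ = ∫ y, (∫ x, ψ x * (f (x + y) : ℂ)) ∂besselMeasure s :=
        integral_comp_neg_besselMeasure hs fun y => ∫ x, ψ x * (f (x + y) : ℂ)
    _ = ∫ x, ∫ y, ψ x * (f (x + y) : ℂ) ∂besselMeasure s := (integral_integral_swap h2).symm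
    _ = _ := by
        congr 1; ext x
        rw [integral_const_mul, integral_complex_ofReal]

theorem isSteadyWave_iff {s : ℝ} (hs : 0 < s) (κ μ : ℝ) (φ : ℝ →ᵇ ℝ) :
    IsSteadyWave s κ μ φ ↔
      ∀ x, -μ * φ x + 1 / 2 * φ x ^ 2 + 3 / 2 * besselConv hs (φ ^ 2) x = κ := by
  constructor
  · rintro ⟨g, hg, h⟩
    rw [besselOp_toDistribution hs] at hg
    rwa [toDistribution_injective hg]
  · exact fun h => ⟨_, besselOp_toDistribution hs _, h⟩

end FDP
end

noncomputable section

namespace FDP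

open MeasureTheory ProbabilityTheory

namespace EvenHolder

variable {P : ℝ} {β : ℝ≥0}

/-! ### The Banach algebra of even periodic Hölder functions -/

theorem even (f : EvenHolder P β) (x : ℝ) : toBCF f (-x) = toBCF f x := f.2.2.1 x

theorem periodic (f : EvenHolder P β) : Function.Periodic (toBCF f) P := f.2.2.2

@[ext]
theorem ext {f g : EvenHolder P β} (h : ∀ x, toBCF f x = toBCF g x) : f = g :=
  toBCF_injective (BoundedContinuousFunction.ext h)

theorem norm_toBCF_le (f : EvenHolder P β) : ‖toBCF f‖ ≤ ‖f‖ := by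
  rw [norm_def]; linarith [(nnHolderNorm β (toBCF f)).coe_nonneg]

theorem abs_apply_le (f : EvenHolder P β) (x : ℝ) : |toBCF f x| ≤ ‖f‖ :=
  ((toBCF f).norm_coe_le_norm x).trans (norm_toBCF_le f)

theorem abs_sub_le (f : EvenHolder P β) (x y : ℝ) :
    |toBCF f x - toBCF f y| ≤ ‖f‖ * |x - y| ^ (β : ℝ) := by
  have h := (memHolder f).holderWith.dist_le x y
  rw [Real.dist_eq, Real.dist_eq] at h
  refine h.trans ?_
  gcongr
  rw [norm_def]; linarith [norm_nonneg (toBCF f)]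

theorem holderWith_of_abs_sub_le {g : ℝ → ℝ} {C : ℝ} (hC : 0 ≤ C)
    (h : ∀ x y, |g x - g y| ≤ C * |x - y| ^ (β : ℝ)) : HolderWith C.toNNReal β g := by
  intro x y
  rw [edist_dist, edist_dist, Real.dist_eq, Real.dist_eq,
    ENNReal.ofReal_rpow_of_nonneg (abs_nonneg _) β.coe_nonneg,
    show ((C.toNNReal : ℝ≥0) : ENNReal) = ENNReal.ofReal C from rfl, ← ENNReal.ofReal_mul hC]
  exact ENNReal.ofReal_le_ofReal (h x y)

/-- The element of `EvenHolder P β` given by a function with an explicit Hölder bound. -/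
def mk (g : ℝ →ᵇ ℝ) (C : ℝ) (hC : 0 ≤ C) (h : ∀ x y, |g x - g y| ≤ C * |x - y| ^ (β : ℝ))
    (he : Function.Even g) (hp : Function.Periodic g P) : EvenHolder P β :=
  ⟨g, (holderWith_of_abs_sub_le hC h).memHolder, he, hp⟩

theorem norm_le_of_bounds (f : EvenHolder P β) {A C : ℝ} (hA : 0 ≤ A) (hC : 0 ≤ C)
    (h0 : ∀ x, |toBCF f x| ≤ A)
    (h : ∀ x y, |toBCF f x - toBCF f y| ≤ C * |x - y| ^ (β : ℝ)) : ‖f‖ ≤ A + C := by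
  rw [norm_def]
  refine add_le_add ((BoundedContinuousFunction.norm_le hA).mpr h0) ?_
  have := (holderWith_of_abs_sub_le hC h).nnholderNorm_le
  calc (nnHolderNorm β (toBCF f) : ℝ) ≤ C.toNNReal := by exact_mod_cast this
    _ = C := Real.coe_toNNReal C hC

@[simp] theorem toBCF_const (c x : ℝ) : toBCF (const c : EvenHolder P β) x = c := rfl

@[simp] theorem toBCF_add_apply (f g : EvenHolder P β) (x : ℝ) :
    toBCF (f + g) x = toBCF f x + toBCF g x := rfl

@[simp] theorem toBCF_sub_apply (f g : EvenHolder P β) (x : ℝ) :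
    toBCF (f - g) x = toBCF f x - toBCF g x := rfl

@[simp] theorem toBCF_smul_apply (c : ℝ) (f : EvenHolder P β) (x : ℝ) :
    toBCF (c • f) x = c * toBCF f x := rfl

@[simp] theorem toBCF_zero_apply (x : ℝ) : toBCF (0 : EvenHolder P β) x = 0 := rfl

/-- The inclusion into the bounded continuous functions. -/
def toBCFL : EvenHolder P β →L[ℝ] (ℝ →ᵇ ℝ) :=
  LinearMap.mkContinuous toBCF 1 fun f => by rw [one_mul]; exact norm_toBCF_le f

@[simp] theorem toBCFL_apply (f : EvenHolder P β) : toBCFL f = toBCF f := rfl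

/-- A Cauchy sequence has a uniform limit. Hölder bounds pass to pointwise limits: for `u n` this
puts the limit in the space, for `u n - u m` it gives convergence in norm. -/
instance : CompleteSpace (EvenHolder P β) := by
  refine Metric.complete_of_cauchySeq_tendsto fun u hu => ?_
  obtain ⟨g, hg⟩ := cauchySeq_tendsto_of_complete
    ((toBCFL (P := P) (β := β)).uniformContinuous.comp_cauchySeq hu)
  have hgx (x : ℝ) : Filter.Tendsto (fun n => toBCF (u n) x) Filter.atTop (𝓝 (g x)) :=
    (((BoundedContinuousFunction.tendsto_iff_tendstoUniformly.mp hg)).tendsto_at x)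
  obtain ⟨C, hC⟩ := hu.norm_bddAbove
  have hC' (n : ℕ) : ‖u n‖ ≤ C := hC ⟨n, rfl⟩
  have hC0 : 0 ≤ C := (norm_nonneg _).trans (hC' 0)
  have hsub (x y : ℝ) : |g x - g y| ≤ C * |x - y| ^ (β : ℝ) := by
    refine le_of_tendsto ((hgx x).sub (hgx y)).abs (Filter.Eventually.of_forall fun n => ?_)
    exact (abs_sub_le (u n) x y).trans (by gcongr; exact hC' n)
  have heven : Function.Even g := fun x =>
    tendsto_nhds_unique (hgx (-x)) ((hgx x).congr fun n => (even (u n) x).symm)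
  have hper : Function.Periodic g P := fun x =>
    tendsto_nhds_unique (hgx (x + P)) ((hgx x).congr fun n => (periodic (u n) x).symm)
  refine ⟨mk g C hC0 hsub heven hper, ?_⟩
  rw [Metric.tendsto_atTop]
  intro ε hε
  obtain ⟨N, hN⟩ := Metric.cauchySeq_iff.mp hu (ε / 3) (by positivity)
  refine ⟨N, fun n hn => ?_⟩
  have hb (m : ℕ) (hm : N ≤ m) : ‖u n - u m‖ ≤ ε / 3 := by
    rw [← dist_eq_norm]; exact (hN n hn m hm).le
  rw [dist_eq_norm]
  refine (norm_le_of_bounds _ (A := ε / 3) (C := ε / 3) (by positivity) (by positivity)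
    (fun x => ?_) (fun x y => ?_)).trans_lt (by linarith)
  · refine le_of_tendsto ((hgx x).const_sub (toBCF (u n) x)).abs
      (Filter.eventually_atTop.mpr ⟨N, fun m hm => ?_⟩)
    exact (abs_apply_le (u n - u m) x).trans (hb m hm)
  · refine le_of_tendsto (((hgx x).const_sub (toBCF (u n) x)).sub
      ((hgx y).const_sub (toBCF (u n) y))).abs (Filter.eventually_atTop.mpr ⟨N, fun m hm => ?_⟩)
    exact (abs_sub_le (u n - u m) x y).trans (by gcongr; exact hb m hm)

theorem abs_mul_sub_mul_le (f g : EvenHolder P β) (x y : ℝ) :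
    |toBCF f x * toBCF g x - toBCF f y * toBCF g y| ≤ 2 * (‖f‖ * ‖g‖) * |x - y| ^ (β : ℝ) := by
  have e : toBCF f x * toBCF g x - toBCF f y * toBCF g y =
      toBCF f x * (toBCF g x - toBCF g y) + (toBCF f x - toBCF f y) * toBCF g y := by ring
  have h1 : |toBCF f x * (toBCF g x - toBCF g y)| ≤ ‖f‖ * (‖g‖ * |x - y| ^ (β : ℝ)) := by
    rw [abs_mul]; exact mul_le_mul (abs_apply_le f x) (abs_sub_le g x y) (abs_nonneg _) (norm_nonneg _)
  have h2 : |(toBCF f x - toBCF f y) * toBCF g y| ≤ (‖f‖ * |x - y| ^ (β : ℝ)) * ‖g‖ := by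
    rw [abs_mul]; exact mul_le_mul (abs_sub_le f x y) (abs_apply_le g y) (abs_nonneg _) (by positivity)
  rw [e]
  refine (abs_add_le _ _).trans ((add_le_add h1 h2).trans (le_of_eq (by ring)))

/-- The pointwise product. -/
def mul (f g : EvenHolder P β) : EvenHolder P β :=
  mk (toBCF f * toBCF g) (2 * (‖f‖ * ‖g‖)) (by positivity) (abs_mul_sub_mul_le f g)
    (fun x => by simp [even]) (fun x => by simp [(periodic f) x, (periodic g) x])

theorem toBCF_mul (f g : EvenHolder P β) : toBCF (mul f g) = toBCF f * toBCF g := rfl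

theorem norm_mul_le' (f g : EvenHolder P β) : ‖mul f g‖ ≤ 3 * ‖f‖ * ‖g‖ := by
  refine (norm_le_of_bounds _ (A := ‖f‖ * ‖g‖) (by positivity) (by positivity) (fun x => ?_)
    (abs_mul_sub_mul_le f g)).trans (le_of_eq (by ring))
  rw [toBCF_mul, BoundedContinuousFunction.mul_apply, abs_mul]
  exact mul_le_mul (abs_apply_le f x) (abs_apply_le g x) (abs_nonneg _) (norm_nonneg _)

/-- The pointwise product as a continuous bilinear map. -/
def mulL : EvenHolder P β →L[ℝ] EvenHolder P β →L[ℝ] EvenHolder P β :=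
  LinearMap.mkContinuous₂ (LinearMap.mk₂ ℝ mul
    (fun f g h => by ext x; simp [toBCF_mul, add_mul])
    (fun c f g => by ext x; simp [toBCF_mul, mul_assoc])
    (fun f g h => by ext x; simp [toBCF_mul, mul_add])
    (fun c f g => by ext x; simp [toBCF_mul]; ring)) 3 norm_mul_le'

@[simp] theorem toBCF_mulL_apply (f g : EvenHolder P β) (x : ℝ) :
    toBCF (mulL f g) x = toBCF f x * toBCF g x := rfl

/-! ### The Bessel operator on Hölder functions -/

theorem abs_besselConv_sub_le {s : ℝ} (hs : 0 < s) (f : EvenHolder P β) (x y : ℝ) :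
    |besselConv hs (toBCF f) x - besselConv hs (toBCF f) y| ≤ ‖f‖ * |x - y| ^ (β : ℝ) := by
  have := isProbabilityMeasure_besselMeasure hs
  rw [besselConv_apply, besselConv_apply, ← integral_sub (integrable_shift hs _ x)
    (integrable_shift hs _ y)]
  have h (z : ℝ) : ‖toBCF f (x + z) - toBCF f (y + z)‖ ≤ ‖f‖ * |x - y| ^ (β : ℝ) := by
    have := abs_sub_le f (x + z) (y + z)
    rwa [add_sub_add_right_eq_sub] at this
  simpa using norm_integral_le_of_norm_le_const (μ := besselMeasure s)
    (Filter.Eventually.of_forall h)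

theorem even_besselConv {s : ℝ} (hs : 0 < s) (f : EvenHolder P β) :
    Function.Even (besselConv hs (toBCF f)) := fun x => by
  rw [besselConv_apply, besselConv_apply, ← integral_comp_neg_besselMeasure hs]
  congr 1; ext y
  rw [← even f]; ring_nf

theorem periodic_besselConv {s : ℝ} (hs : 0 < s) (f : EvenHolder P β) :
    Function.Periodic (besselConv hs (toBCF f)) P := fun x => by
  rw [besselConv_apply, besselConv_apply]
  congr 1; ext y
  rw [← periodic f (x + y)]; ring_nf

/-- The Bessel operator on `EvenHolder P β`. -/
def besselL (P : ℝ) (β : ℝ≥0) {s : ℝ} (hs : 0 < s) : EvenHolder P β →L[ℝ] EvenHolder P β :=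
  LinearMap.mkContinuous
    { toFun := fun f => mk (besselConv hs (toBCF f)) ‖f‖ (norm_nonneg f)
        (abs_besselConv_sub_le hs f) (even_besselConv hs f) (periodic_besselConv hs f)
      map_add' := fun f g => by
        ext x
        exact integral_add (integrable_shift hs _ x) (integrable_shift hs _ x)
      map_smul' := fun c f => by
        ext x
        exact integral_const_mul c _ } 2 fun f => by
    refine (norm_le_of_bounds _ (A := ‖f‖) (C := ‖f‖) (norm_nonneg _) (norm_nonneg _) (fun x => ?_)
      (abs_besselConv_sub_le hs f)).trans (le_of_eq (by ring))
    exact ((besselConv hs (toBCF f)).norm_coe_le_norm x).trans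
      ((norm_besselConv_le hs _).trans (norm_toBCF_le f))

theorem toBCF_besselL {s : ℝ} (hs : 0 < s) (f : EvenHolder P β) :
    toBCF (besselL P β hs f) = besselConv hs (toBCF f) := rfl

/-! ### Cosine modes -/

/-- Interpolates between the Lipschitz bound, used when `ω|x - y| ≤ 1`, and the trivial bound `2`.
-/
theorem abs_cos_sub_cos_le {ω : ℝ} (hω : 0 ≤ ω) (hβ : β ≤ 1) (x y : ℝ) :
    |Real.cos (ω * x) - Real.cos (ω * y)| ≤ 2 * ω ^ (β : ℝ) * |x - y| ^ (β : ℝ) := by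
  rw [mul_assoc, ← Real.mul_rpow hω (abs_nonneg _)]
  have hβ' : (β : ℝ) ≤ 1 := by exact_mod_cast hβ
  have h0 : 0 ≤ ω * |x - y| := by positivity
  rcases le_total (ω * |x - y|) 1 with h | h
  · have h1 : ω * |x - y| ≤ (ω * |x - y|) ^ (β : ℝ) := by
      rcases h0.eq_or_lt with h2 | h2
      · rw [← h2]; positivity
      · simpa using Real.rpow_le_rpow_of_exponent_ge h2 h hβ'
    have h2 : |Real.cos (ω * x) - Real.cos (ω * y)| ≤ |ω * x - ω * y| :=
      Real.abs_cos_sub_cos_le _ _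
    rw [← mul_sub, abs_mul, abs_of_nonneg hω] at h2
    linarith
  · have h1 := Real.one_le_rpow h β.coe_nonneg
    have h2 := Real.abs_cos_le_one (ω * x)
    have h3 := Real.abs_cos_le_one (ω * y)
    have h4 := abs_sub (Real.cos (ω * x)) (Real.cos (ω * y))
    linarith

end EvenHolder

theorem waveNumber_nonneg {P : ℝ} (hP : 0 < P) (n : ℕ) : 0 ≤ waveNumber P n := by
  unfold waveNumber; positivity

theorem waveNumber_mul_period {P : ℝ} (hP : 0 < P) (n : ℕ) :
    waveNumber P n * P = n * (2 * Real.pi) := by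
  unfold waveNumber; field_simp

namespace EvenHolder

variable {P : ℝ} {β : ℝ≥0}

/-- The mode `x ↦ cos (2πnx/P)`. -/
def cosMode (hP : 0 < P) (hβ : β ≤ 1) (n : ℕ) : EvenHolder P β :=
  mk (BoundedContinuousFunction.ofNormedAddCommGroup (fun x => Real.cos (waveNumber P n * x))
      (by fun_prop) 1 fun x => Real.abs_cos_le_one _)
    (2 * waveNumber P n ^ (β : ℝ)) (by have := waveNumber_nonneg hP n; positivity)
    (abs_cos_sub_cos_le (waveNumber_nonneg hP n) hβ)
    (fun x => by simp)
    (fun x => by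
      simp only [BoundedContinuousFunction.coe_ofNormedAddCommGroup]
      rw [mul_add, waveNumber_mul_period hP, Real.cos_add_nat_mul_two_pi])

@[simp] theorem toBCF_cosMode_apply (hP : 0 < P) (hβ : β ≤ 1) (n : ℕ) (x : ℝ) :
    toBCF (cosMode hP hβ n) x = Real.cos (waveNumber P n * x) := rfl

theorem norm_cosMode_le (hP : 0 < P) (hβ : β ≤ 1) (n : ℕ) :
    ‖cosMode hP hβ n‖ ≤ 1 + 2 * waveNumber P n ^ (β : ℝ) :=
  have := waveNumber_nonneg hP n
  norm_le_of_bounds _ zero_le_one (by positivity) (fun x => Real.abs_cos_le_one _)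
    (abs_cos_sub_cos_le this hβ)

end EvenHolder
end FDP
end

noncomputable section

namespace FDP

open MeasureTheory ProbabilityTheory

/-! ### Fourier coefficients -/

theorem integral_cos_int_period {P : ℝ} (hP : 0 < P) (j : ℤ) :
    ∫ x in (0 : ℝ)..P, Real.cos (2 * Real.pi * j / P * x) = if j = 0 then P else 0 := by
  split_ifs with hj
  · simp [hj]
  · have hj' : (j : ℝ) ≠ 0 := by exact_mod_cast hj
    have h0 : 2 * Real.pi * j / P ≠ 0 := by
      have := Real.pi_ne_zero
      have := hP.ne'
      positivity
    rw [intervalIntegral.integral_comp_mul_left _ h0, integral_cos]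
    have : 2 * Real.pi * j / P * P = 2 * Real.pi * j - 0 := by field_simp; ring
    have h2 : Real.sin (2 * Real.pi * j) = 0 := by
      rw [show 2 * Real.pi * (j : ℝ) = ((2 * j : ℤ) : ℝ) * Real.pi by push_cast; ring]
      exact Real.sin_int_mul_pi _
    rw [this, sub_zero, h2]; simp

theorem integral_cos_mul_cos {P : ℝ} (hP : 0 < P) (m n : ℕ) :
    ∫ x in (0 : ℝ)..P, Real.cos (waveNumber P m * x) * Real.cos (waveNumber P n * x) =
      if m = n then (if n = 0 then P else P / 2) else 0 := by
  have e (x : ℝ) : Real.cos (waveNumber P m * x) * Real.cos (waveNumber P n * x) =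
      1 / 2 * Real.cos (2 * Real.pi * ((m - n : ℤ) : ℝ) / P * x) +
      1 / 2 * Real.cos (2 * Real.pi * ((m + n : ℤ) : ℝ) / P * x) := by
    have h1 : 2 * Real.pi * ((m - n : ℤ) : ℝ) / P * x =
      waveNumber P m * x - waveNumber P n * x := by simp only [waveNumber]; push_cast; ring
    have h2 : 2 * Real.pi * ((m + n : ℤ) : ℝ) / P * x =
      waveNumber P m * x + waveNumber P n * x := by simp only [waveNumber]; push_cast; ring
    rw [h1, h2, Real.cos_sub, Real.cos_add]; ring
  simp_rw [e]
  rw [intervalIntegral.integral_add (Continuous.intervalIntegrable (by fun_prop) _ _)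
    (Continuous.intervalIntegrable (by fun_prop) _ _), intervalIntegral.integral_const_mul,
    intervalIntegral.integral_const_mul, integral_cos_int_period hP, integral_cos_int_period hP]
  split_ifs <;> first | omega | ring

namespace EvenHolder

variable {P : ℝ} {β : ℝ≥0}

theorem continuous_toBCF (f : EvenHolder P β) : Continuous (toBCF f) := (toBCF f).continuous

/-- The unnormalised cosine coefficient. -/
def cosIntegral (hP : 0 < P) (n : ℕ) : EvenHolder P β →L[ℝ] ℝ :=
  LinearMap.mkContinuous
    { toFun := fun f => ∫ x in (0 : ℝ)..P, toBCF f x * Real.cos (waveNumber P n * x)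
      map_add' := fun f g => by
        have hf := continuous_toBCF f
        have hg := continuous_toBCF g
        rw [← intervalIntegral.integral_add (Continuous.intervalIntegrable (by fun_prop) _ _)
          (Continuous.intervalIntegrable (by fun_prop) _ _)]
        simp_rw [toBCF_add_apply, add_mul]
      map_smul' := fun c f => by
        simp only [toBCF_smul_apply, RingHom.id_apply, smul_eq_mul, mul_assoc]
        rw [intervalIntegral.integral_const_mul] } P fun f => by
    have := intervalIntegral.norm_integral_le_of_norm_le_const (a := 0) (b := P) (C := ‖f‖)
      (f := fun x => toBCF f x * Real.cos (waveNumber P n * x)) fun x _ => by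
        rw [norm_mul]
        calc _ ≤ ‖f‖ * 1 := mul_le_mul (abs_apply_le f x) (Real.abs_cos_le_one _)
              (abs_nonneg _) (norm_nonneg _)
          _ = ‖f‖ := mul_one _
    rw [sub_zero, abs_of_pos hP] at this
    refine this.trans (le_of_eq (mul_comm _ _))

theorem cosIntegral_apply (hP : 0 < P) (n : ℕ) (f : EvenHolder P β) :
    cosIntegral hP n f = ∫ x in (0 : ℝ)..P, toBCF f x * Real.cos (waveNumber P n * x) := rfl

theorem norm_cosIntegral_le (hP : 0 < P) (n : ℕ) :
    ‖(cosIntegral hP n : EvenHolder P β →L[ℝ] ℝ)‖ ≤ P :=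
  LinearMap.mkContinuous_norm_le _ hP.le _

/-- The normalised cosine coefficient, so that `f = ∑ coeff n f • cosMode n`. -/
def coeff (hP : 0 < P) (n : ℕ) : EvenHolder P β →L[ℝ] ℝ :=
  (if n = 0 then P else P / 2)⁻¹ • cosIntegral hP n

theorem coeff_apply (hP : 0 < P) (n : ℕ) (f : EvenHolder P β) :
    coeff hP n f = (if n = 0 then P else P / 2)⁻¹ * cosIntegral hP n f := rfl

theorem norm_coeff_le (hP : 0 < P) (n : ℕ) : ‖(coeff hP n : EvenHolder P β →L[ℝ] ℝ)‖ ≤ 2 := by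
  rw [coeff, norm_smul]
  have h1 : ‖(if n = 0 then P else P / 2)⁻¹‖ ≤ 2 / P := by
    rw [norm_inv, Real.norm_eq_abs]
    split_ifs
    · rw [abs_of_pos hP, inv_eq_one_div]; gcongr; norm_num
    · rw [abs_of_pos (half_pos hP), inv_div]
  calc _ ≤ 2 / P * P := mul_le_mul h1 (norm_cosIntegral_le hP n) (norm_nonneg _) (by positivity)
    _ = 2 := by field_simp

theorem coeff_cosMode (hP : 0 < P) (hβ : β ≤ 1) (m n : ℕ) :
    coeff hP n (cosMode hP hβ m : EvenHolder P β) = if m = n then 1 else 0 := by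
  rw [coeff_apply, cosIntegral_apply]
  simp_rw [toBCF_cosMode_apply]
  rw [integral_cos_mul_cos hP]
  have := hP.ne'
  split_ifs <;> field_simp <;> simp

theorem coeff_const (hP : 0 < P) {n : ℕ} (hn : n ≠ 0) (c : ℝ) :
    coeff hP n (const c : EvenHolder P β) = 0 := by
  have h := integral_cos_mul_cos hP 0 n
  have hz : waveNumber P 0 = 0 := by simp [waveNumber]
  simp only [hz, zero_mul, Real.cos_zero, one_mul, if_neg hn.symm] at h
  rw [coeff_apply, cosIntegral_apply]
  simp_rw [toBCF_const]
  rw [intervalIntegral.integral_const_mul, h]; simp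

/-- The integrand is odd under `x ↦ P - x`. -/
theorem integral_mul_sin (hP : 0 < P) (n : ℕ) (f : EvenHolder P β) :
    ∫ x in (0 : ℝ)..P, toBCF f x * Real.sin (waveNumber P n * x) = 0 := by
  have h := intervalIntegral.integral_comp_sub_left (a := 0) (b := P)
    (fun x => toBCF f x * Real.sin (waveNumber P n * x)) P
  rw [sub_self, sub_zero] at h
  have e (x : ℝ) : toBCF f (P - x) * Real.sin (waveNumber P n * (P - x)) =
      -(toBCF f x * Real.sin (waveNumber P n * x)) := by
    rw [mul_sub, waveNumber_mul_period hP, Real.sin_nat_mul_two_pi_sub, (periodic f).sub_eq',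
      even]
    ring
  simp_rw [e] at h
  rw [intervalIntegral.integral_neg] at h
  linarith

/-- After translation the weight is `cos (ω(x - y))`; by the addition formula only its cosine part
survives against an even function. -/
theorem cosIntegral_shift (hP : 0 < P) (n : ℕ) (f : EvenHolder P β) (y : ℝ) :
    ∫ x in (0 : ℝ)..P, toBCF f (x + y) * Real.cos (waveNumber P n * x) =
      cosIntegral hP n f * Real.cos (waveNumber P n * y) := by
  have hf := continuous_toBCF f
  have hper : Function.Periodic
      (fun x => toBCF f x * Real.cos (waveNumber P n * (x - y))) P := fun x => by
    simp only
    rw [periodic f, show waveNumber P n * (x + P - y) = waveNumber P n * (x - y) +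
      waveNumber P n * P by ring, waveNumber_mul_period hP, Real.cos_add_nat_mul_two_pi]
  have h1 := intervalIntegral.integral_comp_add_right (a := 0) (b := P)
    (fun x => toBCF f x * Real.cos (waveNumber P n * (x - y))) y
  simp only [add_sub_cancel_right] at h1
  rw [h1, zero_add, add_comm P y, hper.intervalIntegral_add_eq y 0, zero_add]
  have e (x : ℝ) : toBCF f x * Real.cos (waveNumber P n * (x - y)) =
      Real.cos (waveNumber P n * y) * (toBCF f x * Real.cos (waveNumber P n * x)) +
      Real.sin (waveNumber P n * y) * (toBCF f x * Real.sin (waveNumber P n * x)) := by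
    rw [mul_sub, Real.cos_sub]; ring
  simp_rw [e]
  rw [intervalIntegral.integral_add (Continuous.intervalIntegrable (by fun_prop) _ _)
    (Continuous.intervalIntegrable (by fun_prop) _ _), intervalIntegral.integral_const_mul,
    intervalIntegral.integral_const_mul, integral_mul_sin hP, cosIntegral_apply]
  ring

theorem coeff_besselL (hP : 0 < P) {s : ℝ} (hs : 0 < s) (n : ℕ) (f : EvenHolder P β) :
    coeff hP n (besselL P β hs f) = besselSymbol s (waveNumber P n) * coeff hP n f := by
  have := isProbabilityMeasure_besselMeasure hs
  have hf := continuous_toBCF f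
  have hI : Integrable (fun p : ℝ × ℝ => toBCF f (p.1 + p.2) * Real.cos (waveNumber P n * p.1))
      ((volume.restrict (Ioc 0 P)).prod (besselMeasure s)) := by
    refine Integrable.of_bound (C := ‖f‖) (Continuous.aestronglyMeasurable (by fun_prop))
      (Filter.Eventually.of_forall fun p => ?_)
    rw [norm_mul]
    calc _ ≤ ‖f‖ * 1 := mul_le_mul (abs_apply_le f _) (Real.abs_cos_le_one _)
              (abs_nonneg _) (norm_nonneg _)
      _ = ‖f‖ := mul_one _
  have key : cosIntegral hP n (besselL P β hs f) =
      besselSymbol s (waveNumber P n) * cosIntegral hP n f := by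
    rw [cosIntegral_apply, intervalIntegral.integral_of_le hP.le]
    calc ∫ x in Ioc 0 P, toBCF (besselL P β hs f) x * Real.cos (waveNumber P n * x)
        = ∫ x in Ioc 0 P, ∫ y, toBCF f (x + y) * Real.cos (waveNumber P n * x)
            ∂besselMeasure s := by
          congr 1; ext x
          rw [toBCF_besselL, besselConv_apply, integral_mul_const]
      _ = ∫ y, (∫ x in Ioc 0 P, toBCF f (x + y) * Real.cos (waveNumber P n * x))
            ∂besselMeasure s := integral_integral_swap hI
      _ = ∫ y, cosIntegral hP n f * Real.cos (waveNumber P n * y) ∂besselMeasure s := by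
          congr 1; ext y
          rw [← intervalIntegral.integral_of_le hP.le, cosIntegral_shift]
      _ = _ := by rw [integral_const_mul, integral_cos_besselMeasure hs, mul_comm]
  rw [coeff_apply, key, coeff_apply]; ring

/-- Sine integrals vanish by evenness, so all complex Fourier coefficients on the circle are zero.
They are then trivially summable, and the series converges pointwise to `f`. -/
theorem eq_zero_of_coeff_eq_zero (hP : 0 < P) {f : EvenHolder P β}
    (h : ∀ n, coeff hP n f = 0) : f = 0 := by
  have hfact : Fact (0 < P) := ⟨hP⟩
  have hf := continuous_toBCF f
  have hc (n : ℕ) : ∫ x in (0 : ℝ)..P, toBCF f x * Real.cos (waveNumber P n * x) = 0 := by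
    have h1 := h n
    rw [coeff_apply] at h1
    rcases mul_eq_zero.mp h1 with h2 | h2
    · exfalso
      rw [inv_eq_zero] at h2
      split_ifs at h2 <;> linarith
    · exact h2
  have hper : Function.Periodic (fun x => (toBCF f x : ℂ)) P := fun x => by
    simp only [periodic f x]
  let F : C(AddCircle P, ℂ) := ⟨hper.lift, continuous_coinduced_dom.mpr (by
    exact Complex.continuous_ofReal.comp hf)⟩
  have hF (x : ℝ) : F (x : AddCircle P) = (toBCF f x : ℂ) := rfl
  have hcoef (n : ℤ) : fourierCoeff F n = 0 := by
    rw [fourierCoeff_eq_intervalIntegral _ n 0, zero_add]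
    have e (x : ℝ) : (fourier (-n) (x : AddCircle P)) • F (x : AddCircle P) =
        ((toBCF f x * Real.cos (waveNumber P n.natAbs * x) : ℝ) : ℂ) + -(n.sign : ℂ) * Complex.I *
          ((toBCF f x * Real.sin (waveNumber P n.natAbs * x) : ℝ) : ℂ) := by
      rw [fourier_coe_apply, hF, smul_eq_mul]
      have h2 : 2 * (Real.pi : ℂ) * Complex.I * ((-n : ℤ) : ℂ) * (x : ℂ) / (P : ℂ) =
          ((-(n.sign * (waveNumber P n.natAbs * x)) : ℝ) : ℂ) * Complex.I := by
        have hn' : (n : ℂ) = (n.sign : ℂ) * (n.natAbs : ℂ) := by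
          have := congrArg (Int.cast : ℤ → ℂ) (Int.sign_mul_natAbs n)
          rwa [Int.cast_mul, Int.cast_natCast, eq_comm] at this
        simp only [waveNumber]
        push_cast
        rw [hn']
        ring
      rw [h2, Complex.exp_mul_I, ← Complex.ofReal_cos, ← Complex.ofReal_sin, Real.cos_neg,
        Real.sin_neg]
      rcases Int.sign_trichotomy n with h3 | h3 | h3 <;> simp only [h3] <;> push_cast
      · simp; ring
      · have : n = 0 := Int.sign_eq_zero_iff_zero.mp h3
        simp [this, waveNumber]
      · simp; ring
    simp_rw [e]
    rw [intervalIntegral.integral_add (Continuous.intervalIntegrable (by fun_prop) _ _)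
      (Continuous.intervalIntegrable (by fun_prop) _ _), intervalIntegral.integral_const_mul,
      intervalIntegral.integral_ofReal, intervalIntegral.integral_ofReal, hc, integral_mul_sin hP]
    simp
  have hsum : Summable (fourierCoeff F) := by
    rw [show fourierCoeff F = 0 from funext hcoef]; exact summable_zero
  ext x
  have h1 := has_pointwise_sum_fourier_series_of_summable hsum (x : AddCircle P)
  simp only [hcoef, zero_smul] at h1
  have h2 := h1.unique hasSum_zero
  rw [hF] at h2
  simpa using h2

theorem ext_coeff (hP : 0 < P) {f g : EvenHolder P β} (h : ∀ n, coeff hP n f = coeff hP n g) :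
    f = g :=
  sub_eq_zero.mp (eq_zero_of_coeff_eq_zero hP fun n => by rw [map_sub, h, sub_self])

end EvenHolder
end FDP
end

noncomputable section

namespace FDP

open MeasureTheory ProbabilityTheory

/-! ### Inverting the linearisation by Fourier multipliers -/

theorem besselSymbol_pos (s ξ : ℝ) : 0 < besselSymbol s ξ := by
  unfold besselSymbol; positivity

theorem besselSymbol_zero (s : ℝ) : besselSymbol s 0 = 1 := by simp [besselSymbol]

theorem tendsto_waveNumber {P : ℝ} (hP : 0 < P) :
    Filter.Tendsto (waveNumber P) Filter.atTop Filter.atTop := by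
  have h : waveNumber P = fun n : ℕ => (2 * Real.pi / P) * n := by
    ext n; simp only [waveNumber]; ring
  rw [h]
  exact tendsto_natCast_atTop_atTop.const_mul_atTop (by positivity)

theorem tendsto_besselSymbol_waveNumber {P s : ℝ} (hP : 0 < P) (hs : 0 < s) :
    Filter.Tendsto (fun n => besselSymbol s (waveNumber P n)) Filter.atTop (𝓝 0) := by
  have h1 : Filter.Tendsto (fun n => 1 + waveNumber P n ^ 2) Filter.atTop Filter.atTop :=
    Filter.tendsto_atTop_add_const_left _ _
      ((Filter.tendsto_pow_atTop two_ne_zero).comp (tendsto_waveNumber hP))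
  have h2 := (tendsto_rpow_neg_atTop (half_pos hs)).comp h1
  refine h2.congr fun n => ?_
  simp [besselSymbol, neg_div]

namespace EvenHolder

variable {P : ℝ} {β : ℝ≥0}

theorem exists_summable_pow_mul_norm_cosMode (hP : 0 < P) (hβ : β ≤ 1) {s : ℝ} (hs : 0 < s) :
    ∃ N : ℕ, Summable fun n =>
      besselSymbol s (waveNumber P n) ^ N * ‖(cosMode hP hβ n : EvenHolder P β)‖ := by
  -- With `sN/2 ≥ 2`, the `N`-th power of the symbol is at most `(1 + ω²)⁻²`, while the mode's norm
  -- is at most `3(1 + ω²)`.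
  obtain ⟨N, hN⟩ := exists_nat_gt (4 / s)
  refine ⟨N, ?_⟩
  have hN' : 2 ≤ s / 2 * N := by rw [div_lt_iff₀ hs] at hN; linarith
  have hg : Summable fun n : ℕ => 3 * (P / (2 * Real.pi)) ^ 2 * (1 / (n : ℝ) ^ 2) :=
    (Real.summable_one_div_nat_pow.mpr one_lt_two).mul_left _
  refine hg.of_norm_bounded_eventually_nat (Filter.eventually_atTop.mpr ⟨1, fun n hn => ?_⟩)
  have hn' : (0 : ℝ) < n := by exact_mod_cast hn
  set ω := waveNumber P n with hω
  have hω0 : 0 < ω := by rw [hω]; unfold waveNumber; positivity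
  have h1 : 1 ≤ 1 + ω ^ 2 := by nlinarith
  have h2 : besselSymbol s ω ^ N ≤ (1 + ω ^ 2) ^ (-2 : ℝ) := by
    rw [besselSymbol, ← Real.rpow_natCast, ← Real.rpow_mul (by positivity)]
    exact Real.rpow_le_rpow_of_exponent_le h1 (by linarith)
  have h3 : ω ^ (β : ℝ) ≤ 1 + ω ^ 2 := by
    have hβ' : (β : ℝ) ≤ 1 := by exact_mod_cast hβ
    rcases le_total ω 1 with h | h
    · exact (Real.rpow_le_one hω0.le h β.coe_nonneg).trans h1
    · have : ω ^ (β : ℝ) ≤ ω ^ (1 : ℝ) := Real.rpow_le_rpow_of_exponent_le h hβ'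
      rw [Real.rpow_one] at this
      nlinarith
  have h4 : ‖(cosMode hP hβ n : EvenHolder P β)‖ ≤ 3 * (1 + ω ^ 2) :=
    (norm_cosMode_le hP hβ n).trans (by linarith)
  rw [Real.norm_of_nonneg (mul_nonneg (pow_nonneg (besselSymbol_pos _ _).le _) (norm_nonneg _))]
  calc _ ≤ (1 + ω ^ 2) ^ (-2 : ℝ) * (3 * (1 + ω ^ 2)) :=
        mul_le_mul h2 h4 (norm_nonneg _) (by positivity)
    _ = 3 / (1 + ω ^ 2) := by
        rw [Real.rpow_neg (by positivity), Real.rpow_two]; field_simp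
    _ ≤ 3 / ω ^ 2 := by gcongr; linarith
    _ = _ := by rw [hω]; unfold waveNumber; field_simp

/-- The operator is an absolutely convergent series of rank-one operators. -/
theorem exists_multiplier (hP : 0 < P) (hβ : β ≤ 1) (m : ℕ → ℝ)
    (hm : Summable fun n => |m n| * ‖(cosMode hP hβ n : EvenHolder P β)‖) :
    ∃ M : EvenHolder P β →L[ℝ] EvenHolder P β, ∀ n f, coeff hP n (M f) = m n * coeff hP n f := by
  have hsum : Summable fun n => m n • (coeff hP n : EvenHolder P β →L[ℝ] ℝ).smulRight
      (cosMode hP hβ n : EvenHolder P β) := by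
    refine Summable.of_norm_bounded (hm.mul_left 2) fun n => ?_
    rw [norm_smul, ContinuousLinearMap.norm_smulRight_apply, Real.norm_eq_abs]
    have := norm_coeff_le (β := β) hP n
    calc |m n| * (‖coeff hP n‖ * ‖(cosMode hP hβ n : EvenHolder P β)‖)
        ≤ |m n| * (2 * ‖(cosMode hP hβ n : EvenHolder P β)‖) := by gcongr
      _ = _ := by ring
  refine ⟨∑' n, m n • (coeff hP n : EvenHolder P β →L[ℝ] ℝ).smulRight
    (cosMode hP hβ n : EvenHolder P β), fun n f => ?_⟩
  have h1 := (hsum.hasSum.mapL (ContinuousLinearMap.apply ℝ (EvenHolder P β) f)).mapL (coeff hP n)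
  have h2 := h1.unique (hasSum_single n fun k hk => ?_)
  · simpa [coeff_cosMode] using h2
  · simp [coeff_cosMode, hk]

theorem coeff_pow_besselL (hP : 0 < P) {s : ℝ} (hs : 0 < s) (j n : ℕ) (f : EvenHolder P β) :
    coeff hP n ((besselL P β hs ^ j) f) = besselSymbol s (waveNumber P n) ^ j * coeff hP n f := by
  induction j with
  | zero => simp
  | succ j ih =>
    rw [pow_succ', mul_apply_eq_comp, coeff_besselL, ih]; ring

/-- The multipliers `(1 - a b n)⁻¹` tend to `1`, so they are not summable. Subtracting `N` terms of
the geometric series, realised by powers of `besselL`, leaves `(a b n)^N (1 - a b n)⁻¹` for large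
`n`, which is summable against the norms of the modes. The finitely many remaining `n` do not
matter, even where `1 - a b n = 0` and the inverse is `0` by convention. -/
theorem exists_inverse_one_sub (hP : 0 < P) (hβ : β ≤ 1) {s : ℝ} (hs : 0 < s) (a : ℝ) :
    ∃ S : EvenHolder P β →L[ℝ] EvenHolder P β, ∀ n f,
      coeff hP n (S f) = (1 - a * besselSymbol s (waveNumber P n))⁻¹ * coeff hP n f := by
  obtain ⟨N, hN⟩ := exists_summable_pow_mul_norm_cosMode (β := β) hP hβ hs
  set b : ℕ → ℝ := fun n => besselSymbol s (waveNumber P n) with hb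
  obtain ⟨M, hM⟩ := exists_multiplier (β := β) hP hβ
    (fun n => (1 - a * b n)⁻¹ - ∑ j ∈ Finset.range N, (a * b n) ^ j) (by
      refine (hN.mul_left (2 * |a| ^ N)).of_norm_bounded_eventually_nat ?_
      have ht : Filter.Tendsto (fun n => a * b n) Filter.atTop (𝓝 0) := by
        simpa using (tendsto_besselSymbol_waveNumber hP hs).const_mul a
      filter_upwards [ht.eventually (gt_mem_nhds (show (0 : ℝ) < 1 / 2 by norm_num))] with n hn
      have hpos : 0 < 1 - a * b n := by linarith
      have e : (1 - a * b n)⁻¹ - ∑ j ∈ Finset.range N, (a * b n) ^ j =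
          (a * b n) ^ N * (1 - a * b n)⁻¹ := by
        have := mul_neg_geom_sum (a * b n) N
        field_simp
        linarith
      have hinv : (1 - a * b n)⁻¹ ≤ 2 := by
        rw [inv_le_comm₀ hpos two_pos]; linarith
      have hbn : 0 < b n := besselSymbol_pos _ _
      rw [norm_mul, norm_norm, Real.norm_eq_abs, abs_abs, e, abs_mul, abs_pow, abs_mul,
        abs_of_pos hbn, abs_of_pos (inv_pos.mpr hpos), mul_pow]
      calc |a| ^ N * b n ^ N * (1 - a * b n)⁻¹ * ‖(cosMode hP hβ n : EvenHolder P β)‖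
          ≤ |a| ^ N * b n ^ N * 2 * ‖(cosMode hP hβ n : EvenHolder P β)‖ := by gcongr
        _ = _ := by ring)
  refine ⟨(∑ j ∈ Finset.range N, a ^ j • besselL P β hs ^ j) + M, fun n f => ?_⟩
  rw [add_apply, map_add, hM, sum_apply, map_sum]
  simp only [smul_apply, map_smul, coeff_pow_besselL, smul_eq_mul]
  rw [sub_mul, Finset.sum_mul]
  simp only [mul_pow, mul_assoc, hb]
  ring

/-- The linearisation `(c - μ) + 3c J^{-s}` of the equation at the constant `c`. -/
def linearization (P : ℝ) (β : ℝ≥0) {s : ℝ} (hs : 0 < s) (c μ : ℝ) :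
    EvenHolder P β →L[ℝ] EvenHolder P β :=
  (c - μ) • ContinuousLinearMap.id ℝ _ + (3 * c) • besselL P β hs

theorem coeff_linearization (hP : 0 < P) {s : ℝ} (hs : 0 < s) (c μ : ℝ) (n : ℕ)
    (f : EvenHolder P β) : coeff hP n (linearization P β hs c μ f) =
      (c - μ + 3 * c * besselSymbol s (waveNumber P n)) * coeff hP n f := by
  simp [linearization, coeff_besselL]; ring

/-- Factoring out `c - μ` reduces to `1 - a J^{-s}`. The convention `0⁻¹ = 0` makes `S` vanish on
kernel modes, so `S` inverts on the complementary modes. -/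
theorem exists_pseudoinverse_linearization (hP : 0 < P) (hβ : β ≤ 1) {s : ℝ} (hs : 0 < s)
    {c μ : ℝ} (hc : c ≠ μ) :
    ∃ S : EvenHolder P β →L[ℝ] EvenHolder P β, ∀ n f,
      coeff hP n (S f) =
        (c - μ + 3 * c * besselSymbol s (waveNumber P n))⁻¹ * coeff hP n f := by
  obtain ⟨S, hS⟩ := exists_inverse_one_sub (β := β) hP hβ hs (-(3 * c) / (c - μ))
  have h0 : c - μ ≠ 0 := sub_ne_zero.mpr hc
  refine ⟨(c - μ)⁻¹ • S, fun n f => ?_⟩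
  rw [smul_apply, map_smul, hS, smul_eq_mul, ← mul_assoc, ← mul_inv]
  congr 2
  field_simp
  ring

end EvenHolder
end FDP
end

noncomputable section

namespace FDP

/-! ### Bifurcation from a simple eigenvalue for quadratic nonlinearities -/

section Bifurcation

open scoped ContDiff

variable {X : Type*} [NormedAddCommGroup X] [NormedSpace ℝ X]

/-- For a solution, `u - a(u)e = S L_{μ₀} u = -S((L_μ - L_{μ₀})u + B(u,u))`, which is at most a
small multiple of `‖u‖`; the part of `‖u‖` off the kernel direction is absorbed on the left. -/
theorem eventually_norm_sub_le_of_quadratic {L : ℝ → X →L[ℝ] X} {μ₀ : ℝ}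
    (hL : ContinuousAt L μ₀) (B : X →L[ℝ] X →L[ℝ] X) (S : X →L[ℝ] X) (a : X →L[ℝ] ℝ) (e : X)
    (hS : ∀ u, S (L μ₀ u) = u - a u • e) {η : ℝ} (hη : 0 < η) :
    ∀ᶠ p : X × ℝ in 𝓝 (0, μ₀), L p.2 p.1 + B p.1 p.1 = 0 →
      ‖p.1 - a p.1 • e‖ ≤ η * |a p.1| := by
  have hL2 : ContinuousAt (fun p : X × ℝ => L p.2) (0, μ₀) :=
    ContinuousAt.comp (f := fun p : X × ℝ => p.2) (g := L) hL continuousAt_snd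
  have hθ : ContinuousAt (fun p : X × ℝ => ‖S‖ * (‖L p.2 - L μ₀‖ + ‖B‖ * ‖p.1‖)) (0, μ₀) := by
    fun_prop
  have hθ0 : ‖S‖ * (‖L μ₀ - L μ₀‖ + ‖B‖ * ‖(0 : X)‖) = 0 := by simp
  -- `θ ≤ 1/2` allows the absorption, at the cost of a factor `2`; the last condition then gives
  -- `η`.
  obtain ⟨θ, hθpos, hθ1, hθ2⟩ : ∃ θ : ℝ, 0 < θ ∧ θ ≤ 1 / 2 ∧ 2 * θ * ‖e‖ ≤ η := by
    refine ⟨min (1 / 2) (η / (2 * (‖e‖ + 1))), by positivity, min_le_left _ _, ?_⟩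
    have h1 : min (1 / 2) (η / (2 * (‖e‖ + 1))) ≤ η / (2 * (‖e‖ + 1)) := min_le_right _ _
    have hpos : 0 < ‖e‖ + 1 := by positivity
    calc _ ≤ 2 * (η / (2 * (‖e‖ + 1))) * (‖e‖ + 1) := by gcongr; linarith
      _ = η := by field_simp
  have hlt := hθ.eventually (gt_mem_nhds (show
    ‖S‖ * (‖L ((0, μ₀) : X × ℝ).2 - L μ₀‖ + ‖B‖ * ‖((0, μ₀) : X × ℝ).1‖) < θ by
      simpa only [hθ0] using hθpos))
  filter_upwards [hlt] with p hp hsol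
  obtain ⟨u, μ⟩ := p
  simp only at hp hsol ⊢
  have e1 : u - a u • e = -S ((L μ - L μ₀) u + B u u) := by
    have h : (L μ - L μ₀) u + B u u = -(L μ₀ u) := by
      rw [sub_apply, sub_add_eq_add_sub, hsol, zero_sub]
    rw [h, map_neg, neg_neg, hS]
  have e2 : ‖u - a u • e‖ ≤ θ * ‖u‖ := by
    rw [e1, norm_neg]
    calc ‖S ((L μ - L μ₀) u + B u u)‖ ≤ ‖S‖ * (‖L μ - L μ₀‖ * ‖u‖ + ‖B‖ * ‖u‖ * ‖u‖) :=
          (S.le_opNorm _).trans (by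
            gcongr
            exact (norm_add_le _ _).trans
              (add_le_add ((L μ - L μ₀).le_opNorm u) (B.le_opNorm₂ u u)))
      _ = ‖S‖ * (‖L μ - L μ₀‖ + ‖B‖ * ‖u‖) * ‖u‖ := by ring
      _ ≤ θ * ‖u‖ := by gcongr
  have e3 : ‖u‖ ≤ ‖u - a u • e‖ + |a u| * ‖e‖ := by
    calc ‖u‖ = ‖(u - a u • e) + a u • e‖ := by rw [sub_add_cancel]
      _ ≤ _ := (norm_add_le _ _).trans (by rw [norm_smul, Real.norm_eq_abs])
  have h1 : ‖u - a u • e‖ ≤ 2 * θ * ‖e‖ * |a u| := by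
    nlinarith [norm_nonneg (u - a u • e)]
  exact h1.trans (by gcongr)

theorem eventually_eq_zero_of_quadratic {L : ℝ → X →L[ℝ] X} {μ₀ : ℝ}
    (hL : ContinuousAt L μ₀) (B : X →L[ℝ] X →L[ℝ] X) (S : X →L[ℝ] X)
    (hS : ∀ u, S (L μ₀ u) = u) :
    ∀ᶠ p : X × ℝ in 𝓝 (0, μ₀), L p.2 p.1 + B p.1 p.1 = 0 → p.1 = 0 := by
  have h := eventually_norm_sub_le_of_quadratic hL B S 0 0 (by simpa using hS) one_pos
  filter_upwards [h] with p hp hsol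
  simpa using hp hsol

/-- The desingularised map `(t, w, μ) ↦ (t, a w - 1, L_μ w + t B(w, w))`. -/
def blowUp (L : ℝ → X →L[ℝ] X) (B : X →L[ℝ] X →L[ℝ] X) (a : X →L[ℝ] ℝ) (p : ℝ × X × ℝ) :
    ℝ × ℝ × X :=
  (p.1, a p.2.1 - 1, L p.2.2 p.2.1 + p.1 • B p.2.1 p.2.1)

theorem contDiffAt_blowUp {L : ℝ → X →L[ℝ] X} {μ₀ : ℝ} (hL : ContDiffAt ℝ ω L μ₀)
    (B : X →L[ℝ] X →L[ℝ] X) (a : X →L[ℝ] ℝ) (e : X) :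
    ContDiffAt ℝ ω (blowUp L B a) (0, e, μ₀) := by
  have h1 : ContDiffAt ℝ ω (fun p : ℝ × X × ℝ => L p.2.2) (0, e, μ₀) :=
    ContDiffAt.comp (g := L) (f := fun p : ℝ × X × ℝ => p.2.2) _ hL (by fun_prop)
  have h2 : ContDiffAt ℝ ω (fun p : ℝ × X × ℝ => B p.2.1) (0, e, μ₀) :=
    B.contDiff.contDiffAt.comp (f := fun p : ℝ × X × ℝ => p.2.1) _ (by fun_prop)
  have h3 : ContDiffAt ℝ ω (fun p : ℝ × X × ℝ => p.2.1) (0, e, μ₀) := by fun_prop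
  have h4 : ContDiffAt ℝ ω (fun p : ℝ × X × ℝ => a p.2.1) (0, e, μ₀) :=
    a.contDiff.contDiffAt.comp (f := fun p : ℝ × X × ℝ => p.2.1) _ (by fun_prop)
  exact contDiffAt_fst.prodMk ((h4.sub contDiffAt_const).prodMk
    ((h1.clm_apply h3).add (contDiffAt_fst.smul (h2.clm_apply h3))))

/-- The derivative of `blowUp` at `(0, e, μ₀)`. -/
def blowUpDeriv (L₀ L' : X →L[ℝ] X) (B : X →L[ℝ] X →L[ℝ] X) (a : X →L[ℝ] ℝ) (e : X) :
    (ℝ × X × ℝ) →L[ℝ] ℝ × ℝ × X :=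
  let π₁ := ContinuousLinearMap.fst ℝ ℝ (X × ℝ)
  let π₂ := (ContinuousLinearMap.fst ℝ X ℝ).comp (ContinuousLinearMap.snd ℝ ℝ (X × ℝ))
  let π₃ := (ContinuousLinearMap.snd ℝ X ℝ).comp (ContinuousLinearMap.snd ℝ ℝ (X × ℝ))
  π₁.prod ((a.comp π₂).prod
    (L₀.comp π₂ + π₃.smulRight (L' e) + π₁.smulRight (B e e)))

theorem blowUpDeriv_apply (L₀ L' : X →L[ℝ] X) (B : X →L[ℝ] X →L[ℝ] X) (a : X →L[ℝ] ℝ) (e : X)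
    (p : ℝ × X × ℝ) : blowUpDeriv L₀ L' B a e p =
      (p.1, a p.2.1, L₀ p.2.1 + p.2.2 • L' e + p.1 • B e e) := rfl

theorem hasFDerivAt_blowUp {L : ℝ → X →L[ℝ] X} {μ₀ : ℝ} {L' : X →L[ℝ] X}
    (hL : HasDerivAt L L' μ₀) (B : X →L[ℝ] X →L[ℝ] X) (a : X →L[ℝ] ℝ) (e : X) :
    HasFDerivAt (blowUp L B a) (blowUpDeriv (L μ₀) L' B a e) (0, e, μ₀) := by
  let π₁ := ContinuousLinearMap.fst ℝ ℝ (X × ℝ)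
  let π₂ := (ContinuousLinearMap.fst ℝ X ℝ).comp (ContinuousLinearMap.snd ℝ ℝ (X × ℝ))
  let π₃ := (ContinuousLinearMap.snd ℝ X ℝ).comp (ContinuousLinearMap.snd ℝ ℝ (X × ℝ))
  have h1 : HasFDerivAt (fun p : ℝ × X × ℝ => L p.2.2) _ (0, e, μ₀) :=
    HasFDerivAt.comp (g := L) (f := π₃) (0, e, μ₀) hL.hasFDerivAt π₃.hasFDerivAt
  have h2 : HasFDerivAt (fun p : ℝ × X × ℝ => B p.2.1) _ (0, e, μ₀) :=
    B.hasFDerivAt.comp (f := π₂) (0, e, μ₀) π₂.hasFDerivAt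
  have h3 : HasFDerivAt (fun p : ℝ × X × ℝ => p.2.1) π₂ (0, e, μ₀) := π₂.hasFDerivAt
  have h4 : HasFDerivAt (fun p : ℝ × X × ℝ => a p.2.1) _ (0, e, μ₀) :=
    a.hasFDerivAt.comp (f := π₂) (0, e, μ₀) π₂.hasFDerivAt
  have h5 : HasFDerivAt (fun p : ℝ × X × ℝ => p.1) π₁ (0, e, μ₀) := π₁.hasFDerivAt
  have h := h5.prodMk ((h4.sub_const 1).prodMk
    ((h1.clm_apply h3).add (h5.smul (h2.clm_apply h3))))
  refine h.congr_fderiv ?_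
  ext <;> simp [blowUpDeriv, π₁, π₂, π₃]

/-- `L₀` misses exactly the direction seen by `a`; transversality `a (L' e) ≠ 0` lets the speed
variable supply it, and the `a`-component fixes the kernel part of `w`. -/
theorem bijective_blowUpDeriv {L₀ L' : X →L[ℝ] X} (B : X →L[ℝ] X →L[ℝ] X) {a : X →L[ℝ] ℝ} {e : X}
    {S : X →L[ℝ] X} (hae : a e = 1) (haL : ∀ u, a (L₀ u) = 0) (haS : ∀ y, a (S y) = 0)
    (hSL : ∀ u, S (L₀ u) = u - a u • e) (hLS : ∀ y, L₀ (S y) = y - a y • e)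
    (hLe : L₀ e = 0) (hd : a (L' e) ≠ 0) :
    Function.Bijective (blowUpDeriv L₀ L' B a e) := by
  constructor
  · rw [injective_iff_map_eq_zero]
    rintro ⟨τ, w, m⟩ h
    rw [blowUpDeriv_apply, Prod.mk_eq_zero, Prod.mk_eq_zero] at h
    obtain ⟨h1, h2, h3⟩ := h
    simp only at h1 h2 h3
    subst h1
    rw [zero_smul, add_zero] at h3
    have h4 : m = 0 := by
      have := congrArg a h3
      rw [map_add, haL, zero_add, map_smul, map_zero, smul_eq_mul] at this
      exact (mul_eq_zero.mp this).resolve_right hd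
    subst h4
    rw [zero_smul, add_zero] at h3
    have h5 := hSL w
    rw [h3, h2, map_zero, zero_smul, sub_zero] at h5
    rw [← h5]; rfl
  · rintro ⟨τ, α, y⟩
    set z := y - τ • B e e with hz
    -- Chosen so that `z - m • L' e` is annihilated by `a`, hence equals `L₀` of its image under
    -- `S`.
    set m := a z / a (L' e) with hm
    refine ⟨(τ, α • e + S (z - m • L' e), m), ?_⟩
    rw [blowUpDeriv_apply]
    have h1 : a (z - m • L' e) = 0 := by
      rw [map_sub, map_smul, smul_eq_mul, hm]; field_simp; ring
    refine Prod.ext rfl (Prod.ext ?_ ?_)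
    · simp [hae, haS]
    · simp only [map_add, map_smul, hLe, hLS, h1]
      simp [hz]

/-- Bifurcation from a simple eigenvalue, with the local uniqueness of the branch, for
`L_μ u + B(u, u) = 0` at `(0, μ₀)`. The branch is `t ↦ (t w(t), μ(t))` with `q t = (w(t), μ(t))`. -/
theorem exists_branch_of_quadratic [CompleteSpace X] {L : ℝ → X →L[ℝ] X} {μ₀ : ℝ} {L' : X →L[ℝ] X}
    (hL : ContDiffAt ℝ ω L μ₀) (hL' : HasDerivAt L L' μ₀) (B : X →L[ℝ] X →L[ℝ] X)
    {a : X →L[ℝ] ℝ} {e : X} {S : X →L[ℝ] X} (hae : a e = 1) (haL : ∀ u, a (L μ₀ u) = 0)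
    (haS : ∀ y, a (S y) = 0) (hSL : ∀ u, S (L μ₀ u) = u - a u • e)
    (hLS : ∀ y, L μ₀ (S y) = y - a y • e) (hLe : L μ₀ e = 0) (hd : a (L' e) ≠ 0)
    {U : Set ℝ} (hU : U ∈ 𝓝 μ₀) :
    ∃ ε > 0, ∃ q : ℝ → X × ℝ, AnalyticOnNhd ℝ q (Ioo (-ε) ε) ∧ q 0 = (e, μ₀) ∧
      (∀ t ∈ Ioo (-ε) ε, a (q t).1 = 1 ∧ L (q t).2 (q t).1 + t • B (q t).1 (q t).1 = 0 ∧
        (q t).2 ∈ U) ∧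
      ∀ᶠ p : X × ℝ in 𝓝 (0, μ₀), L p.2 p.1 + B p.1 p.1 = 0 → p.1 ≠ 0 →
        ∃ t ∈ Ioo (-ε) ε, p.1 = t • (q t).1 ∧ p.2 = (q t).2 := by
  have hΨ := contDiffAt_blowUp hL B a e
  have hbij := bijective_blowUpDeriv B hae haL haS hSL hLS hLe hd
  let T : (ℝ × X × ℝ) ≃L[ℝ] ℝ × ℝ × X := ContinuousLinearEquiv.ofBijective
    (blowUpDeriv (L μ₀) L' B a e) (LinearMap.ker_eq_bot.mpr hbij.1)
    (LinearMap.range_eq_top.mpr hbij.2)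
  have hT : HasFDerivAt (blowUp L B a) (T : (ℝ × X × ℝ) →L[ℝ] ℝ × ℝ × X) (0, e, μ₀) :=
    hasFDerivAt_blowUp hL' B a e
  have hω : (ω : WithTop ℕ∞) ≠ 0 := by simp
  have hst := hΨ.hasStrictFDerivAt' hT hω
  have hval : blowUp L B a (0, e, μ₀) = (0, 0, 0) := by simp [blowUp, hae, hLe]
  set g := hΨ.localInverse hT hω with hg
  have hginv : g (0, 0, 0) = (0, e, μ₀) := by
    rw [← hval]; exact hΨ.localInverse_apply_image hT hω
  have hgan : AnalyticAt ℝ g (0, 0, 0) := by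
    rw [← hval]; exact (hΨ.to_localInverse hT hω).analyticAt
  have hright : ∀ᶠ y in 𝓝 ((0, 0, 0) : ℝ × ℝ × X), blowUp L B a (g y) = y := by
    rw [← hval]; exact hst.eventually_right_inverse
  have hleft : ∀ᶠ x in 𝓝 ((0, e, μ₀) : ℝ × X × ℝ), g (blowUp L B a x) = x :=
    hst.eventually_left_inverse
  -- The branch is the preimage of this line under the local inverse of `blowUp`.
  let ι : ℝ → ℝ × ℝ × X := fun t => (t, 0, 0)
  have hι : AnalyticAt ℝ ι 0 := by
    exact analyticAt_id.prod (analyticAt_const.prod analyticAt_const)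
  have hG : AnalyticAt ℝ (fun t => g (ι t)) 0 := AnalyticAt.comp (g := g) (f := ι) hgan hι
  have hq : AnalyticAt ℝ (fun t => (g (ι t)).2) 0 := by
    exact analyticAt_snd.comp hG
  have hUev : ∀ᶠ t in 𝓝 (0 : ℝ), (g (ι t)).2.2 ∈ U := by
    have hc : ContinuousAt (fun t => (g (ι t)).2.2) 0 :=
      continuousAt_snd.comp hq.continuousAt
    refine hc.eventually_mem ?_
    have : g (ι 0) = (0, e, μ₀) := hginv
    rw [this]; exact hU
  have hιc : Filter.Tendsto ι (𝓝 0) (𝓝 (0, 0, 0)) := hι.continuousAt.tendsto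
  obtain ⟨ε, hε, hball⟩ := Metric.eventually_nhds_iff_ball.mp
    (hq.eventually_analyticAt.and (hUev.and (hιc.eventually hright)))
  rw [Real.ball_eq_Ioo, zero_sub, zero_add] at hball
  refine ⟨ε, hε, fun t => (g (ι t)).2, fun t ht => (hball t ht).1, ?_, fun t ht => ?_, ?_⟩
  · have : g (ι 0) = (0, e, μ₀) := hginv
    simp only [this]
  · obtain ⟨-, h1, h2⟩ := hball t ht
    have h3 := congrArg Prod.fst h2
    have h4 := congrArg (fun p => p.2.1) h2
    have h5 := congrArg (fun p => p.2.2) h2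
    simp only [blowUp, ι] at h3 h4 h5
    refine ⟨sub_eq_zero.mp h4, ?_, h1⟩
    rw [h3] at h5
    exact h5
  · obtain ⟨r, hr, hrball⟩ := Metric.eventually_nhds_iff_ball.mp hleft
    -- Uniqueness: with `t = a u`, the estimate forces `t ≠ 0` and puts `t⁻¹ u` within `r / 2` of
    -- `e`, in the region where the local inverse is a left inverse.
    have hest := eventually_norm_sub_le_of_quadratic hL.continuousAt B S a e hSL (half_pos hr)
    have ha0 : ContinuousAt (fun p : X × ℝ => |a p.1|) (0, μ₀) := by fun_prop
    have ha1 := ha0.eventually (gt_mem_nhds (show |a ((0, μ₀) : X × ℝ).1| < min ε r by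
      simpa using ⟨hε, hr⟩))
    have hm0 : ContinuousAt (fun p : X × ℝ => |p.2 - μ₀|) (0, μ₀) := by fun_prop
    have hm1 := hm0.eventually (gt_mem_nhds (show |((0, μ₀) : X × ℝ).2 - μ₀| < r by simpa using hr))
    filter_upwards [hest, ha1, hm1] with p h1 h2 h3 hsol hne
    obtain ⟨u, μ⟩ := p
    simp only at h1 h2 h3 hsol hne ⊢
    specialize h1 hsol
    set t := a u with ht
    have ht0 : t ≠ 0 := by
      intro h0
      rw [h0] at h1
      simp at h1
      exact hne h1
    obtain ⟨h2a, h2b⟩ := lt_min_iff.mp h2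
    have hw : ‖t⁻¹ • u - e‖ < r := by
      have : t⁻¹ • u - e = t⁻¹ • (u - t • e) := by rw [smul_sub, inv_smul_smul₀ ht0]
      rw [this, norm_smul, norm_inv, Real.norm_eq_abs]
      have hpos : 0 < |t| := abs_pos.mpr ht0
      calc |t|⁻¹ * ‖u - t • e‖ ≤ |t|⁻¹ * (r / 2 * |t|) := by gcongr
        _ = r / 2 := by field_simp
        _ < r := half_lt_self hr
    have hmem : (t, t⁻¹ • u, μ) ∈ Metric.ball ((0, e, μ₀) : ℝ × X × ℝ) r := by
      rw [Metric.mem_ball, Prod.dist_eq, Prod.dist_eq, max_lt_iff, max_lt_iff]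
      refine ⟨?_, ?_, ?_⟩
      · simpa [Real.dist_eq] using h2b
      · rw [dist_eq_norm]; exact hw
      · rw [Real.dist_eq]; exact h3
    have hkey := hrball _ hmem
    have hb : blowUp L B a (t, t⁻¹ • u, μ) = ι t := by
      simp only [blowUp, ι, map_smul, smul_apply, smul_inv_smul₀ ht0, ← ht]
      refine Prod.ext rfl (Prod.ext ?_ ?_)
      · simp [ht0]
      · rw [← smul_add, hsol, smul_zero]
    rw [hb] at hkey
    refine ⟨t, abs_lt.mp h2a, ?_, ?_⟩
    · rw [hkey]; simp [ht0]
    · rw [hkey]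

end Bifurcation

end FDP
end

noncomputable section

namespace FDP

/-! ### The dispersion relation -/

theorem besselSymbol_strictAntiOn {s : ℝ} (hs : 0 < s) : StrictAntiOn (besselSymbol s) (Ici 0) := by
  intro x hx y hy hxy
  have hx : 0 ≤ x := hx
  unfold besselSymbol
  exact Real.rpow_lt_rpow_of_neg (by positivity) (by nlinarith) (by linarith)

theorem besselSymbol_le_one {s : ℝ} (hs : 0 < s) (ξ : ℝ) : besselSymbol s ξ ≤ 1 :=
  Real.rpow_le_one_of_one_le_of_nonpos (by nlinarith [sq_nonneg ξ]) (by linarith)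

theorem besselSymbol_threshold {s : ℝ} (hs : 0 < s) : besselSymbol s (threshold s) = 1 / 3 := by
  have h : (1 : ℝ) ≤ 3 ^ (2 / s) := Real.one_le_rpow (by norm_num) (by positivity)
  rw [besselSymbol, threshold, Real.sq_sqrt (by linarith), add_sub_cancel,
    ← Real.rpow_mul (by norm_num), show 2 / s * (-s / 2) = -1 by field_simp, Real.rpow_neg_one,
    one_div]

theorem waveNumber_injective {P : ℝ} (hP : 0 < P) : Function.Injective (waveNumber P) := by
  intro m n h
  unfold waveNumber at h
  have := Real.pi_ne_zero
  field_simp at h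
  exact_mod_cast h

theorem besselSymbol_waveNumber_injective {P s : ℝ} (hP : 0 < P) (hs : 0 < s) :
    Function.Injective fun n => besselSymbol s (waveNumber P n) := fun _ _ h =>
  waveNumber_injective hP ((besselSymbol_strictAntiOn hs).injOn (waveNumber_nonneg hP _)
    (waveNumber_nonneg hP _) h)

theorem waveNumber_lt_threshold_iff {P s : ℝ} (hP : 0 < P) (hs : 0 < s) (k : ℕ) :
    waveNumber P k < threshold s ↔ 1 / 3 < besselSymbol s (waveNumber P k) := by
  rw [← besselSymbol_threshold hs]
  exact ((besselSymbol_strictAntiOn hs).lt_iff_gt (Real.sqrt_nonneg _) (waveNumber_nonneg hP k)).symm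

theorem threshold_lt_waveNumber_iff {P s : ℝ} (hP : 0 < P) (hs : 0 < s) (k : ℕ) :
    threshold s < waveNumber P k ↔ besselSymbol s (waveNumber P k) < 1 / 3 := by
  rw [← besselSymbol_threshold hs]
  exact ((besselSymbol_strictAntiOn hs).lt_iff_gt (waveNumber_nonneg hP k) (Real.sqrt_nonneg _)).symm

theorem gammaPlus_quadratic {κ μ : ℝ} (h : 0 ≤ μ ^ 2 + 8 * κ) :
    2 * gammaPlus κ μ ^ 2 - μ * gammaPlus κ μ = κ := by
  unfold gammaPlus; nlinarith [Real.sq_sqrt h]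

theorem gammaMinus_quadratic {κ μ : ℝ} (h : 0 ≤ μ ^ 2 + 8 * κ) :
    2 * gammaMinus κ μ ^ 2 - μ * gammaMinus κ μ = κ := by
  unfold gammaMinus; nlinarith [Real.sq_sqrt h]

/-- The value of `γ_+` at the bifurcation point for a symbol value `b`. -/
def criticalValue (κ b : ℝ) : ℝ := √(κ / (1 - 3 * b))

/-- The wave speed of the bifurcation point for a symbol value `b`. -/
def criticalSpeed (κ b : ℝ) : ℝ := (1 + 3 * b) * criticalValue κ b

theorem criticalValue_pos {κ b : ℝ} (h : 0 < κ / (1 - 3 * b)) : 0 < criticalValue κ b :=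
  Real.sqrt_pos.mpr h

theorem criticalValue_sq {κ b : ℝ} (h : 0 < κ / (1 - 3 * b)) :
    criticalValue κ b ^ 2 * (1 - 3 * b) = κ := by
  have hb : 1 - 3 * b ≠ 0 := by rintro h0; simp [h0] at h
  rw [criticalValue, Real.sq_sqrt h.le]; field_simp

/-- The discriminant is a perfect square, which makes `gammaPlus` explicit at the critical speed. -/
theorem criticalSpeed_sq_add {κ b : ℝ} (h : 0 < κ / (1 - 3 * b)) :
    criticalSpeed κ b ^ 2 + 8 * κ = (3 * (1 - b) * criticalValue κ b) ^ 2 := by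
  rw [criticalSpeed]; linear_combination -8 * criticalValue_sq h

theorem gammaPlus_criticalSpeed {κ b : ℝ} (h : 0 < κ / (1 - 3 * b)) (hb : b ≤ 1) :
    gammaPlus κ (criticalSpeed κ b) = criticalValue κ b := by
  have := criticalValue_pos h
  rw [gammaPlus, criticalSpeed_sq_add h, Real.sqrt_sq (mul_nonneg (by linarith) this.le),
    criticalSpeed]
  ring

/-- Eliminating `μ` gives `κ = c² (1 - 3b)`, whose only positive root is the critical value. -/
theorem eq_criticalSpeed {κ μ c b : ℝ} (hq : 2 * c ^ 2 - μ * c = κ) (hc : 0 < c)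
    (hcb : c * (1 + 3 * b) = μ) (hb : 1 - 3 * b ≠ 0) : μ = criticalSpeed κ b := by
  have h1 : κ / (1 - 3 * b) = c ^ 2 := by
    rw [div_eq_iff hb, ← hq, ← hcb]; ring
  rw [criticalSpeed, criticalValue, h1, Real.sqrt_sq hc.le, ← hcb]; ring

theorem Admissible.div_pos {s κ P : ℝ} {k : ℕ} (hP : 0 < P) (hs : 0 < s)
    (h : Admissible s κ P k) : 0 < κ / (1 - 3 * besselSymbol s (waveNumber P k)) := by
  rcases h.2 with ⟨h1, h2⟩ | ⟨h1, h2⟩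
  · rw [waveNumber_lt_threshold_iff hP hs] at h2
    exact div_pos_of_neg_of_neg h1 (by linarith)
  · rw [threshold_lt_waveNumber_iff hP hs] at h2
    exact _root_.div_pos h1 (by linarith)

theorem besselSymbol_waveNumber_lt_one {P s : ℝ} (hP : 0 < P) (hs : 0 < s) {k : ℕ} (hk : 1 ≤ k) :
    besselSymbol s (waveNumber P k) < 1 := by
  rw [← besselSymbol_zero s]
  have hk' : (0 : ℝ) < k := by exact_mod_cast hk
  have h0 : 0 < waveNumber P k := by unfold waveNumber; positivity
  exact besselSymbol_strictAntiOn hs self_mem_Ici h0.le h0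

theorem admissible_of_critical {s κ P : ℝ} (hP : 0 < P) (hs : 0 < s)
    (hκ : κ = 0 → ∀ k : ℕ, 1 ≤ k → waveNumber P k ≠ threshold s) {c μ : ℝ} {n : ℕ} (hμ : 0 < μ)
    (hD : 0 < μ ^ 2 + 8 * κ) (hc : c = gammaPlus κ μ ∨ c = gammaMinus κ μ)
    (hn : c - μ + 3 * c * besselSymbol s (waveNumber P n) = 0) :
    Admissible s κ P n ∧ c = gammaPlus κ μ ∧
      μ = criticalSpeed κ (besselSymbol s (waveNumber P n)) := by
  set b := besselSymbol s (waveNumber P n) with hb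
  have hb0 : 0 < b := besselSymbol_pos _ _
  have hb1 : b ≤ 1 := besselSymbol_le_one hs _
  have hcb : c * (1 + 3 * b) = μ := by linarith
  have hc0 : 0 < c := by
    by_contra h
    have := mul_nonpos_of_nonpos_of_nonneg (not_lt.mp h) (show 0 ≤ 1 + 3 * b by linarith)
    linarith
  have hsq := Real.sqrt_pos.mpr hD
  -- From `b ≤ 1`. This excludes `γ_-`, where `4c < μ`.
  have hle : μ ≤ 4 * c := by nlinarith
  have hplus : c = gammaPlus κ μ := by
    rcases hc with h | h
    · exact h
    · exfalso; unfold gammaMinus at h; linarith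
  have hq : 2 * c ^ 2 - μ * c = κ := by rw [hplus]; exact gammaPlus_quadratic hD.le
  have hκc : κ = c ^ 2 * (1 - 3 * b) := by rw [← hq, ← hcb]; ring
  -- For `n = 0` the symbol is `1`, so `4c = μ` and the discriminant would vanish.
  have hn1 : 1 ≤ n := by
    by_contra h
    have hn0 : n = 0 := by omega
    have : b = 1 := by rw [hb, hn0]; simp [waveNumber, besselSymbol_zero]
    rw [this] at hcb
    unfold gammaPlus at hplus
    linarith
  have hbne : 1 - 3 * b ≠ 0 := by
    intro h
    -- `b = 1/3` would mean `κ = 0` with the wave number at the threshold, the excluded resonance.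
    refine hκ (by rw [hκc, h, mul_zero]) n hn1 ((besselSymbol_strictAntiOn hs).injOn
      (waveNumber_nonneg hP _) (Real.sqrt_nonneg _) ?_)
    rw [← hb, besselSymbol_threshold hs]; linarith
  refine ⟨⟨hn1, ?_⟩, hplus, eq_criticalSpeed hq hc0 hcb hbne⟩
  rw [waveNumber_lt_threshold_iff hP hs, threshold_lt_waveNumber_iff hP hs, ← hb, hκc]
  have hc2 : 0 < c ^ 2 := by positivity
  rcases lt_or_gt_of_ne hbne with h | h
  · exact Or.inl ⟨mul_neg_of_pos_of_neg hc2 h, by linarith⟩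
  · exact Or.inr ⟨mul_pos hc2 h, by linarith⟩

theorem continuous_gammaPlus (κ : ℝ) : Continuous (gammaPlus κ) := by
  unfold gammaPlus; fun_prop

theorem continuous_gammaMinus (κ : ℝ) : Continuous (gammaMinus κ) := by
  unfold gammaMinus; fun_prop

theorem contDiffAt_gammaPlus {κ μ : ℝ} (h : 0 < μ ^ 2 + 8 * κ) {n : WithTop ℕ∞} :
    ContDiffAt ℝ n (gammaPlus κ) μ := by
  have h1 : ContDiffAt ℝ n (fun μ : ℝ => μ ^ 2 + 8 * κ) μ := by fun_prop
  exact (contDiffAt_id.add (h1.sqrt h.ne')).div_const 4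

theorem hasDerivAt_gammaPlus {κ μ : ℝ} (h : 0 < μ ^ 2 + 8 * κ) :
    HasDerivAt (gammaPlus κ) (gammaPlus κ μ / (4 * gammaPlus κ μ - μ)) μ := by
  have h1 : HasDerivAt (fun μ : ℝ => μ ^ 2 + 8 * κ) (2 * μ) μ := by
    simpa using (hasDerivAt_pow 2 μ).add_const (8 * κ)
  have h2 := ((hasDerivAt_id μ).add (h1.sqrt h.ne')).div_const 4
  refine h2.congr_deriv ?_
  have hs := (Real.sqrt_pos.mpr h).ne'
  unfold gammaPlus
  rw [show 4 * ((μ + √(μ ^ 2 + 8 * κ)) / 4) - μ = √(μ ^ 2 + 8 * κ) by ring]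
  field_simp
  ring

/-! ### Local analysis at the constant solutions -/

namespace EvenHolder

variable {P : ℝ} {β : ℝ≥0}

theorem const_eq_smul (c : ℝ) : (const c : EvenHolder P β) = c • const 1 := by
  ext x; simp

theorem besselL_const {s : ℝ} (hs : 0 < s) (c : ℝ) :
    besselL P β hs (const c) = const c := by
  have := isProbabilityMeasure_besselMeasure hs
  ext x
  rw [toBCF_besselL, besselConv_apply]
  simp

/-- The quadratic part `½ uv + (3/2) J^{-s}(uv)` of the equation. -/
def quadraticPart (P : ℝ) (β : ℝ≥0) {s : ℝ} (hs : 0 < s) :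
    EvenHolder P β →L[ℝ] EvenHolder P β →L[ℝ] EvenHolder P β :=
  ContinuousLinearMap.compL ℝ _ _ _
    ((1 / 2 : ℝ) • ContinuousLinearMap.id ℝ _ + (3 / 2 : ℝ) • besselL P β hs) ∘L mulL

theorem quadraticPart_apply {s : ℝ} (hs : 0 < s) (u v : EvenHolder P β) :
    quadraticPart P β hs u v =
      (1 / 2 : ℝ) • mulL u v + (3 / 2 : ℝ) • besselL P β hs (mulL u v) := rfl

/-- The expansion about `c` is exact because the nonlinearity is quadratic; `J^{-s}` fixes
constants, so the terms without `u` cancel by `hc`. -/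
theorem mem_solutionSet_iff {s : ℝ} (hs : 0 < s) {κ c μ : ℝ} (hc : 2 * c ^ 2 - μ * c = κ)
    (φ : EvenHolder P β) : (φ, μ) ∈ solutionSet s κ P β ↔
      linearization P β hs c μ (φ - const c) +
        quadraticPart P β hs (φ - const c) (φ - const c) = 0 := by
  obtain ⟨u, rfl⟩ : ∃ u, φ = const c + u := ⟨φ - const c, by abel⟩
  rw [add_sub_cancel_left]
  have hsq : toBCF (const c + u) ^ 2 = toBCF (const (c ^ 2) + (2 * c) • u + mulL u u) := by
    ext x
    simp
    ring
  rw [solutionSet, mem_ofPred_eq, isSteadyWave_iff hs]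
  simp only
  rw [hsq, ← toBCF_besselL, map_add (besselL P β hs), map_add (besselL P β hs), besselL_const,
    map_smul (besselL P β hs)]
  constructor
  · intro h
    ext x
    have := h x
    simp [linearization, quadraticPart_apply] at this ⊢
    linear_combination this - hc
  · intro h x
    have := congrArg (fun f => toBCF f x) h
    simp [linearization, quadraticPart_apply] at this ⊢
    linear_combination this + hc

theorem nonconstant_iff_sub_ne_zero (φ : EvenHolder P β) :
    φ.Nonconstant ↔ ∀ c, φ - const c ≠ 0 := by
  simp only [Nonconstant, sub_ne_zero]

theorem hasDerivAt_linearization {s : ℝ} (hs : 0 < s) {c : ℝ → ℝ} {c' μ : ℝ}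
    (hc : HasDerivAt c c' μ) : HasDerivAt (fun μ => linearization P β hs (c μ) μ)
      ((c' - 1) • ContinuousLinearMap.id ℝ _ + (3 * c') • besselL P β hs) μ :=
  have h : HasDerivAt (fun μ => 3 * c μ) (3 * c') μ := hc.const_mul 3
  ((hc.sub (hasDerivAt_id μ)).smul_const _).add (h.smul_const (besselL P β hs))

theorem continuousAt_linearization {s : ℝ} (hs : 0 < s) {c : ℝ → ℝ} {μ : ℝ}
    (hc : ContinuousAt c μ) : ContinuousAt (fun μ => linearization P β hs (c μ) μ) μ :=
  ((hc.sub continuousAt_id).smul continuousAt_const).add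
    ((hc.const_mul 3).smul continuousAt_const)

theorem contDiffAt_linearization {s : ℝ} (hs : 0 < s) {c : ℝ → ℝ} {μ : ℝ} {n : WithTop ℕ∞}
    (hc : ContDiffAt ℝ n c μ) : ContDiffAt ℝ n (fun μ => linearization P β hs (c μ) μ) μ :=
  ((hc.sub contDiffAt_id).smul contDiffAt_const).add
    ((contDiffAt_const.mul hc).smul contDiffAt_const)

theorem tendsto_sub_const {c : ℝ → ℝ} {μ₀ : ℝ} (hc : ContinuousAt c μ₀) :
    Filter.Tendsto (fun p : EvenHolder P β × ℝ => (p.1 - const (c p.2), p.2))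
      (𝓝 (const (c μ₀), μ₀)) (𝓝 (0, μ₀)) := by
  have h1 : ContinuousAt (fun p : EvenHolder P β × ℝ => c p.2) (const (c μ₀), μ₀) :=
    ContinuousAt.comp (f := fun p : EvenHolder P β × ℝ => p.2) (g := c) hc continuousAt_snd
  have h2 : ContinuousAt (fun p : EvenHolder P β × ℝ => (p.1 - c p.2 • const 1, p.2))
      (const (c μ₀), μ₀) := by fun_prop
  simp_rw [const_eq_smul (c _)]
  have h3 := h2.tendsto
  simp only [← const_eq_smul, sub_self] at h3 ⊢
  exact h3

/-- Near a constant solution with invertible linearisation all solutions are constant. -/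
theorem eventually_notMem_nonconstantSolutions (hP : 0 < P) (hβ : β ≤ 1) {s : ℝ} (hs : 0 < s)
    {κ μ₀ : ℝ} {c : ℝ → ℝ} (hc : ContinuousAt c μ₀)
    (hq : ∀ᶠ μ in 𝓝 μ₀, 2 * c μ ^ 2 - μ * c μ = κ) (hne : c μ₀ ≠ μ₀)
    (hnc : ∀ n, c μ₀ - μ₀ + 3 * c μ₀ * besselSymbol s (waveNumber P n) ≠ 0) :
    ∀ᶠ p : EvenHolder P β × ℝ in 𝓝 (const (c μ₀), μ₀), p ∉ nonconstantSolutions s κ P β := by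
  obtain ⟨S, hS⟩ := exists_pseudoinverse_linearization (β := β) hP hβ hs hne
  have h1 := (tendsto_sub_const (P := P) (β := β) hc).eventually
    (eventually_eq_zero_of_quadratic (continuousAt_linearization hs hc) (quadraticPart P β hs) S
      (fun u => ext_coeff hP fun n => by
        rw [hS, coeff_linearization, inv_mul_cancel_left₀ (hnc n)]))
  have h2 := (continuousAt_snd (p := ((const (c μ₀), μ₀) : EvenHolder P β × ℝ))).eventually hq
  filter_upwards [h1, h2] with p hp hp2 hmem
  exact (nonconstant_iff_sub_ne_zero _).mp hmem.2 _ (hp ((mem_solutionSet_iff hs hp2 p.1).mp hmem.1))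

/-- The bifurcation branch at a constant solution on `γ_+` whose linearisation has the kernel
spanned by the `k`-th mode. -/
theorem exists_branch (hP : 0 < P) (hβ : β ≤ 1) {s : ℝ} (hs : 0 < s) {κ μ₀ : ℝ} (hκ : κ ≠ 0)
    (hμ : 0 < μ₀) (hD : 0 < μ₀ ^ 2 + 8 * κ) {k : ℕ} (hk : 1 ≤ k)
    (hcrit : gammaPlus κ μ₀ * (1 + 3 * besselSymbol s (waveNumber P k)) = μ₀) :
    ∃ ε > 0, ∃ Q : ℝ → EvenHolder P β × ℝ, AnalyticOnNhd ℝ Q (Ioo (-ε) ε) ∧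
      Q 0 = (const (gammaPlus κ μ₀), μ₀) ∧
      (∀ t ∈ Ioo (-ε) ε, Q t ∈ solutionSet s κ P β) ∧
      (∀ t ∈ Ioo (-ε) ε, t ≠ 0 → (Q t).1.Nonconstant) ∧
      ∀ᶠ p : EvenHolder P β × ℝ in 𝓝 (const (gammaPlus κ μ₀), μ₀),
        p ∈ nonconstantSolutions s κ P β → ∃ t ∈ Ioo (-ε) ε, p = Q t := by
  set γ := gammaPlus κ μ₀ with hγ
  set b : ℕ → ℝ := fun n => besselSymbol s (waveNumber P n) with hb
  have hcrit : γ * (1 + 3 * b k) = μ₀ := hcrit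
  have hb0 (n : ℕ) : 0 < b n := besselSymbol_pos _ _
  have hγ0 : 0 < γ := by
    by_contra h
    have := mul_nonpos_of_nonpos_of_nonneg (not_lt.mp h) (show 0 ≤ 1 + 3 * b k by linarith [hb0 k])
    linarith
  have hne : γ ≠ μ₀ := by nlinarith [hb0 k, mul_pos hγ0 (hb0 k)]
  have hℓk : γ - μ₀ + 3 * γ * b k = 0 := by linarith
  have hℓ (n : ℕ) (hn : n ≠ k) : γ - μ₀ + 3 * γ * b n ≠ 0 := by
    intro h
    have : b n = b k := by
      have : 3 * γ * b n = 3 * γ * b k := by linarith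
      exact mul_left_cancel₀ (by positivity) this
    exact hn (besselSymbol_waveNumber_injective hP hs this)
  obtain ⟨S, hS⟩ := exists_pseudoinverse_linearization (β := β) hP hβ hs hne
  have hcL (n : ℕ) (f : EvenHolder P β) : coeff hP n (linearization P β hs γ μ₀ f) =
    (γ - μ₀ + 3 * γ * b n) * coeff hP n f := coeff_linearization hP hs γ μ₀ n f
  have hcS (n : ℕ) (f : EvenHolder P β) : coeff hP n (S f) =
    (γ - μ₀ + 3 * γ * b n)⁻¹ * coeff hP n f := hS n f
  set e : EvenHolder P β := cosMode hP hβ k with he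
  have hce (n : ℕ) : coeff hP n e = if k = n then 1 else 0 := coeff_cosMode hP hβ k n
  have hmode (u : EvenHolder P β) (n : ℕ) :
      (γ - μ₀ + 3 * γ * b n)⁻¹ * ((γ - μ₀ + 3 * γ * b n) * coeff hP n u) =
        coeff hP n (u - coeff hP k u • e) := by
    rw [map_sub, map_smul, hce, smul_eq_mul]
    rcases eq_or_ne k n with rfl | h
    · rw [hℓk]; simp
    · rw [inv_mul_cancel_left₀ (hℓ n h.symm), if_neg h]; simp
  have hquad : 2 * γ ^ 2 - μ₀ * γ = κ := gammaPlus_quadratic hD.le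
  have hs4 : 0 < 4 * γ - μ₀ := by
    have := Real.sqrt_pos.mpr hD
    rw [hγ, gammaPlus]; linarith
  -- Keeping the branch's speeds in this set keeps `γ_+` analytic and a constant solution along it.
  have hU : {μ : ℝ | 0 < μ ^ 2 + 8 * κ} ∈ 𝓝 μ₀ :=
    (isOpen_lt continuous_const (by fun_prop)).mem_nhds hD
  obtain ⟨ε, hε, q, hqan, hq0, hq, hqu⟩ := exists_branch_of_quadratic
    (L := fun μ => linearization P β hs (gammaPlus κ μ) μ) (e := e) (S := S) (a := coeff hP k)
    (contDiffAt_linearization hs (contDiffAt_gammaPlus hD))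
    (hasDerivAt_linearization hs (hasDerivAt_gammaPlus hD)) (quadraticPart P β hs)
    (by simp [hce]) (fun u => by rw [hcL, hℓk, zero_mul])
    (fun u => by rw [hcS, hℓk, inv_zero, zero_mul])
    (fun u => ext_coeff hP fun n => by rw [hcS, hcL, hmode])
    (fun u => ext_coeff hP fun n => by rw [hcL, hcS, mul_left_comm, hmode])
    (ext_coeff hP fun n => by
      rw [hcL, hce, map_zero]
      split_ifs with h
      · rw [← h, hℓk, zero_mul]
      · rw [mul_zero])
    (by
      simp only [add_apply, smul_apply, ContinuousLinearMap.id_apply, map_add, map_smul,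
        coeff_besselL, hce, if_true, smul_eq_mul, mul_one]
      rw [← hγ]
      change γ / (4 * γ - μ₀) - 1 + 3 * (γ / (4 * γ - μ₀)) * b k ≠ 0
      -- Transversality: the `μ`-derivative of the critical multiplier vanishes only if `μ₀ = 2γ`,
      -- and then `κ = 2γ² - μ₀γ = 0`.
      have h1 : γ / (4 * γ - μ₀) - 1 + 3 * (γ / (4 * γ - μ₀)) * b k =
          (2 * μ₀ - 4 * γ) / (4 * γ - μ₀) := by
        rw [eq_div_iff hs4.ne']
        linear_combination (1 + 3 * b k) * div_mul_cancel₀ γ hs4.ne' + hcrit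
      rw [h1]
      refine div_ne_zero (fun h => hκ ?_) hs4.ne'
      rw [← hquad, show μ₀ = 2 * γ by linarith]; ring) hU
  refine ⟨ε, hε, fun t => (const (gammaPlus κ (q t).2) + t • (q t).1, (q t).2), ?_, ?_, ?_, ?_, ?_⟩
  · intro t ht
    have h1 : AnalyticAt ℝ (fun t => (q t).1) t := analyticAt_fst.comp (hqan t ht)
    have h2 : AnalyticAt ℝ (fun t => (q t).2) t := analyticAt_snd.comp (hqan t ht)
    have h3 : AnalyticAt ℝ (fun t => gammaPlus κ (q t).2) t :=
      AnalyticAt.comp (g := gammaPlus κ) (f := fun t => (q t).2)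
        (contDiffAt_gammaPlus (hq t ht).2.2).analyticAt h2
    simp_rw [const_eq_smul (gammaPlus κ _)]
    exact ((h3.smul analyticAt_const).add (analyticAt_id.smul h1)).prod h2
  · simp [hq0, ← hγ]
  · intro t ht
    obtain ⟨-, h2, h3⟩ := hq t ht
    rw [mem_solutionSet_iff hs (gammaPlus_quadratic (le_of_lt h3)), add_sub_cancel_left]
    have := congrArg (t • ·) h2
    simpa only [map_smul, smul_apply, smul_add, smul_zero] using this
  -- The `k`-th cosine coefficient of the branch is `t`, while that of a constant is `0`.
  · intro t ht ht0 c hc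
    have h1 := congrArg (coeff hP k) hc
    have hk0 : k ≠ 0 := by omega
    rw [map_add, coeff_const hP hk0, coeff_const hP hk0, map_smul, (hq t ht).1, zero_add,
      smul_eq_mul, mul_one] at h1
    exact ht0 h1
  · have h1 := (tendsto_sub_const (P := P) (β := β)
      (continuous_gammaPlus κ).continuousAt).eventually hqu
    have h2 := (continuousAt_snd (p := ((const γ, μ₀) : EvenHolder P β × ℝ))).eventually hU
    filter_upwards [h1, h2] with p hp hp2 hmem
    obtain ⟨t, ht, h3, h4⟩ := hp
      ((mem_solutionSet_iff hs (gammaPlus_quadratic (le_of_lt hp2)) p.1).mp hmem.1)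
      ((nonconstant_iff_sub_ne_zero _).mp hmem.2 _)
    refine ⟨t, ht, Prod.ext ?_ h4⟩
    simp only at h3 h4 ⊢
    rw [← h3, ← h4, add_sub_cancel]

end EvenHolder

end FDP
end

/-! ### Classification of the points of the constant curves, and the main theorem -/

noncomputable section

namespace FDP

namespace EvenHolder

variable {P : ℝ} {β : ℝ≥0}

theorem isBifurcationPoint_of_branch {s κ c μ ε : ℝ} (hε : 0 < ε) {Q : ℝ → EvenHolder P β × ℝ}
    (hQ : ContinuousAt Q 0) (hQ0 : Q 0 = (const c, μ))
    (hsol : ∀ t ∈ Ioo (-ε) ε, Q t ∈ solutionSet s κ P β)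
    (hnc : ∀ t ∈ Ioo (-ε) ε, t ≠ 0 → (Q t).1.Nonconstant) : IsBifurcationPoint s κ P β c μ := by
  have h0 : (0 : ℝ) ∈ Ioo (-ε) ε := ⟨by linarith, hε⟩
  refine ⟨hQ0 ▸ hsol 0 h0, ?_⟩
  have ht : Filter.Tendsto Q (𝓝[≠] 0) (𝓝 (const c, μ)) := by
    rw [← hQ0]; exact hQ.tendsto.mono_left nhdsWithin_le_nhds
  refine mem_closure_of_tendsto ht ?_
  filter_upwards [self_mem_nhdsWithin, nhdsWithin_le_nhds (isOpen_Ioo.mem_nhds h0)] with t h1 h2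
  exact ⟨hsol t h2, hnc t h2 h1⟩

/-- A point of the constant curves is either a critical point on `γ_+` with an admissible wave
number, or all solutions near it are constant. -/
theorem admissible_or_eventually_notMem (hP : 0 < P) (hβ : β ≤ 1) {s : ℝ} (hs : 0 < s) {κ : ℝ}
    (hκ : κ = 0 → ∀ k : ℕ, 1 ≤ k → waveNumber P k ≠ threshold s) {c μ : ℝ}
    (h : (c, μ) ∈ constantCurves κ) :
    (∃ k, Admissible s κ P k ∧ c = gammaPlus κ μ ∧
      μ = criticalSpeed κ (besselSymbol s (waveNumber P k))) ∨
    ∀ᶠ p : EvenHolder P β × ℝ in 𝓝 (const c, μ), p ∉ nonconstantSolutions s κ P β := by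
  obtain ⟨hμ, hD, hc, hne⟩ := h
  simp only at hμ hD hc hne
  have hD' : 0 < μ ^ 2 + 8 * κ := by linarith
  by_cases hcr : ∃ n, c - μ + 3 * c * besselSymbol s (waveNumber P n) = 0
  · obtain ⟨n, hn⟩ := hcr
    exact Or.inl ⟨n, admissible_of_critical hP hs hκ hμ hD' hc hn⟩
  · push Not at hcr
    have hev : ∀ᶠ μ' in 𝓝 μ, 0 ≤ μ' ^ 2 + 8 * κ :=
      ((show ContinuousAt (fun μ' : ℝ => μ' ^ 2 + 8 * κ) μ by fun_prop).eventually
        (lt_mem_nhds hD')).mono fun _ h => le_of_lt h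
    refine Or.inr ?_
    rcases hc with rfl | rfl
    · exact eventually_notMem_nonconstantSolutions hP hβ hs (continuous_gammaPlus κ).continuousAt
        (hev.mono fun _ h => gammaPlus_quadratic h) hne hcr
    · exact eventually_notMem_nonconstantSolutions hP hβ hs (continuous_gammaMinus κ).continuousAt
        (hev.mono fun _ h => gammaMinus_quadratic h) hne hcr

end EvenHolder

end FDP

end

theorem proposition4p7 (s : ℝ) (hs0 : 0 < s) (hs1 : s < 1) (β : ℝ≥0) (hsβ : s < β) (hβ1 : β < 1)
    (κ P : ℝ) (hP : 0 < P)
    (hκ : κ = 0 → ∀ k : ℕ, 1 ≤ k → FDP.waveNumber P k ≠ FDP.threshold s) :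
    ∃ (μs ε : ℕ → ℝ) (Q : ℕ → ℝ → FDP.EvenHolder P β × ℝ),
      -- the bifurcation points and the local analytic curves
      (∀ k, FDP.Admissible s κ P k →
        (κ < 0 → √(-8 * κ) < μs k) ∧
        (0 < κ → √κ < μs k) ∧
        (∀ μ, 0 < μ → -μ ^ 2 / 8 < κ →
          (FDP.besselSymbol s (FDP.waveNumber P k) =
            1 / 3 * ((μ - FDP.gammaPlus κ μ) / FDP.gammaPlus κ μ) ↔ μ = μs k)) ∧
        FDP.IsBifurcationPoint s κ P β (FDP.gammaPlus κ (μs k)) (μs k) ∧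
        0 < ε k ∧
        AnalyticOnNhd ℝ (Q k) (Ioo (-ε k) (ε k)) ∧
        Q k 0 = (FDP.EvenHolder.const (FDP.gammaPlus κ (μs k)), μs k) ∧
        (∀ t ∈ Ioo (-ε k) (ε k), Q k t ∈ FDP.solutionSet s κ P β) ∧
        (∀ t ∈ Ioo (-ε k) (ε k), t ≠ 0 → (Q k t).1.Nonconstant)) ∧
      -- there are no other bifurcation points on the constant curves
      (∀ c μ, (c, μ) ∈ FDP.constantCurves κ → FDP.IsBifurcationPoint s κ P β c μ →
        ∃ k, FDP.Admissible s κ P k ∧ c = FDP.gammaPlus κ μ ∧ μ = μs k) ∧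
      -- near the constant curves every nonconstant solution lies on one of the local curves
      (∃ O : Set (FDP.EvenHolder P β × ℝ), IsOpen O ∧
        (∀ c μ, (c, μ) ∈ FDP.constantCurves κ → (FDP.EvenHolder.const c, μ) ∈ O) ∧
        ∀ p ∈ O, p ∈ FDP.nonconstantSolutions s κ P β →
          ∃ k, FDP.Admissible s κ P k ∧ ∃ t ∈ Ioo (-ε k) (ε k), p = Q k t) := by
  open FDP FDP.EvenHolder in
  set b : ℕ → ℝ := fun k => besselSymbol s (waveNumber P k) with hb
  have hβ : β ≤ 1 := hβ1.le
  have hb0 (k : ℕ) : 0 < b k := besselSymbol_pos _ _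
  have hb1 {k : ℕ} (hk : Admissible s κ P k) : b k < 1 :=
    besselSymbol_waveNumber_lt_one hP hs0 hk.1
  have hdiv {k : ℕ} (hk : Admissible s κ P k) : 0 < κ / (1 - 3 * b k) := hk.div_pos hP hs0
  have hγ {k : ℕ} (hk : Admissible s κ P k) :
      gammaPlus κ (criticalSpeed κ (b k)) = criticalValue κ (b k) :=
    gammaPlus_criticalSpeed (hdiv hk) (hb1 hk).le
  have hμ {k : ℕ} (hk : Admissible s κ P k) : 0 < criticalSpeed κ (b k) :=
    mul_pos (by linarith [hb0 k]) (criticalValue_pos (hdiv hk))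
  have hD {k : ℕ} (hk : Admissible s κ P k) : 0 < criticalSpeed κ (b k) ^ 2 + 8 * κ := by
    rw [criticalSpeed_sq_add (hdiv hk)]
    exact pow_pos (mul_pos (by linarith [hb1 hk]) (criticalValue_pos (hdiv hk))) 2
  have hbranch (k : ℕ) : ∃ (ε : ℝ) (Q : ℝ → EvenHolder P β × ℝ), Admissible s κ P k →
      0 < ε ∧ AnalyticOnNhd ℝ Q (Ioo (-ε) ε) ∧
      Q 0 = (const (gammaPlus κ (criticalSpeed κ (b k))), criticalSpeed κ (b k)) ∧
      (∀ t ∈ Ioo (-ε) ε, Q t ∈ solutionSet s κ P β) ∧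
      (∀ t ∈ Ioo (-ε) ε, t ≠ 0 → (Q t).1.Nonconstant) ∧
      ∀ᶠ p : EvenHolder P β × ℝ in
        𝓝 (const (gammaPlus κ (criticalSpeed κ (b k))), criticalSpeed κ (b k)),
        p ∈ nonconstantSolutions s κ P β → ∃ t ∈ Ioo (-ε) ε, p = Q t := by
    by_cases hk : Admissible s κ P k
    · have hκ0 : κ ≠ 0 := by
        rintro rfl
        have := hdiv hk
        simp at this
      obtain ⟨ε, hε, Q, h⟩ := exists_branch (β := β) hP hβ hs0 hκ0 (hμ hk) (hD hk) hk.1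
        (by rw [hγ hk, criticalSpeed]; ring)
      exact ⟨ε, Q, fun _ => ⟨hε, h⟩⟩
    -- Dummy values for inadmissible `k`, about which nothing is claimed.
    · exact ⟨0, fun _ => 0, fun h => absurd h hk⟩
  choose ε Q hQ using hbranch
  refine ⟨fun k => criticalSpeed κ (b k), ε, Q, ?_, ?_, ?_⟩
  · intro k hk
    obtain ⟨hε, han, h0, hsol, hnc, -⟩ := hQ k hk
    have hr := criticalValue_pos (hdiv hk)
    have hsq := criticalValue_sq (hdiv hk)
    refine ⟨fun _ => ?_, fun _ => ?_, fun μ hμ0 hμκ => ⟨fun h => ?_, ?_⟩,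
      isBifurcationPoint_of_branch hε (han 0 ⟨by linarith, hε⟩).continuousAt h0 hsol hnc,
      hε, han, h0, hsol, hnc⟩
    · rw [Real.sqrt_lt' (hμ hk)]
      linarith [hD hk]
    -- With `r` the critical value, `κ = r²(1 - 3b) < r²(1 + 3b)²`.
    · rw [Real.sqrt_lt' (hμ hk), criticalSpeed]
      nlinarith [hb0 k, mul_pos (pow_pos hr 2) (hb0 k), mul_pos (mul_pos (pow_pos hr 2) (hb0 k)) (hb0 k)]
    -- Division by zero yields `0`, which the positive symbol cannot equal.
    · have hγ0 : gammaPlus κ μ ≠ 0 := by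
        intro h1
        rw [h1, div_zero, mul_zero] at h
        exact (hb0 k).ne' h
      have hcb : gammaPlus κ μ * (1 + 3 * b k) = μ := by
        change b k = _ at h
        rw [h]; field_simp; ring
      have hpos : 0 < gammaPlus κ μ := by
        by_contra h1
        have := mul_nonpos_of_nonpos_of_nonneg (not_lt.mp h1)
          (show 0 ≤ 1 + 3 * b k by linarith [hb0 k])
        linarith
      refine eq_criticalSpeed (gammaPlus_quadratic (by linarith)) hpos hcb fun h1 => ?_
      have := hdiv hk
      rw [h1, div_zero] at this
      exact this.false
    · intro h1
      rw [show μ = criticalSpeed κ (b k) from h1, hγ hk, criticalSpeed]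
      change b k = _
      field_simp
      ring
  · intro c μ hmem hbif
    rcases admissible_or_eventually_notMem (β := β) hP hβ hs0 hκ hmem with h | h
    · exact h
    · exact absurd h (mem_closure_iff_frequently.mp hbif.2)
  -- The largest open set with the required property; that it contains the constant curves is then a
  -- local statement at each point.
  · refine ⟨interior {p | p ∈ nonconstantSolutions s κ P β →
      ∃ k, Admissible s κ P k ∧ ∃ t ∈ Ioo (-ε k) (ε k), p = Q k t}, isOpen_interior, ?_,
      fun p hp => interior_subset hp⟩
    intro c μ hmem
    rw [mem_interior_iff_mem_nhds]
    rcases admissible_or_eventually_notMem (β := β) hP hβ hs0 hκ hmem with ⟨k, hk, rfl, hμk⟩ | h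
    · have h1 := (hQ k hk).2.2.2.2.2
      rw [hμk]
      exact h1.mono fun p hp hn => ⟨k, hk, hp hn⟩
    · exact h.mono fun p hp hn => absurd hn hp
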